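/- Let $\mathbb S^1=\mathbb R/\mathbb Z$ and let $f:\mathbb S^1\times\mathbb R\to\mathbb R$ be a $C^\infty$ function. Say that $f$ is *wild at* $+\infty$ (resp. $-\infty$) if $$\int_I\frac{ds}{\max(1,\sup_{t}f(t,s))}<\infty\quad\text{and}\quad\int_I\frac{ds}{\max(1,\sup_{t}(-f(t,s)))}<\infty$$ for $I=[0,+\infty)$ (resp. $I=(-\infty,0]$), and that $f$ is *tame* if it is neither wild at $+\infty$ nor wild at $-\infty$. Let $(B^1,B^0)$ be either $(C^1(\mathbb S^1;\mathbb R),C^0(\mathbb S^1;\mathbb R))$ or $(H^1(\mathbb S^1;\mathbb R),L^2(\mathbb S^1;\mathbb R))$, where $H^1$ is the Hilbert space of periodic absolutely continuous functions with derivative in $L^2$. Let $F:B^1\to B^0$, $F(u)(t)=u'(t)+f(t,u(t))$. For $u$ in $B^1$ or $B^0$ write $u=\tilde u+\bar u$ with $\bar u=\int_{\mathbb S^1}u$ (a constant) and $\int\tilde u=0$; let $\tilde B^i=\{u\in B^i:\bar u=0\}$. Call the sets $\{u\in B^i:\bar u=c\}$, $c\in\mathbb R$, horizontal hyperplanes and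 the sets $\tilde v+\mathbb R\cdot 1\subset B^0$, $\tilde v\in\tilde B^0$, vertical lines. **Theorem.** If $f$ is tame then, in both cases, writing $F(\tilde u+\bar u)=\tilde v+\bar v$, the map $\Psi:B^1\to B^0$, $\Psi(u)=\tilde v+\bar u$, is a global $C^\infty$ diffeomorphism. Consequently: 1. (Adapted coordinates.) There is a $C^\infty$ function $\phi:B^0\to\mathbb R$ with $F(\Psi^{-1}(\tilde v+\bar u))=\tilde v+\phi(\tilde v+\bar u)$ for all $\tilde v\in\tilde B^0$, $\bar u\in\mathbb R$; that is, $\mathbf F=F\circ\Psi^{-1}$ has the form $(\tilde v,\bar u)\mapsto(\tilde v,\phi(\tilde v,\bar u))$. 2. For each $c\in\mathbb R$ the map $\tilde B^1\to\tilde B^0$ taking $\tilde u$ to the average-zero part of $F(\tilde u+c)$ is a $C^\infty$ diffeomorphism. 3. (Sheets.) For each $c$, $F$ is injective on the horizontal hyperplane $\{\bar u=c\}$, its image is the graph $\{\tilde v+\psi(\tilde v):\tilde v\in\tilde B^0\}$ of a $C^\infty$ function $\psi:\tilde B^0\to\mathbb R$ (so it meets each vertical line exactly once), and for every $u$ in the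 hyperplane $B^0=DF(u)\tilde B^1\oplus\mathbb R\cdot 1$ (transversality). 4. (Fibres.) For each $\tilde v\in\tilde B^0$ the fibre $F^{-1}(\tilde v+\mathbb R\cdot 1)$ is the image of a $C^\infty$ curve $\gamma:\mathbb R\to B^1$, it meets each horizontal hyperplane $\{\bar u=c\}$ exactly in the point $\gamma(c)$, and $B^1=\mathbb R\gamma'(c)\oplus\tilde B^1$ for all $c$ (transversality). 5. (Foliation.) The fibres foliate $B^1$: the diffeomorphism $\Psi$ maps each fibre $F^{-1}(\tilde v+\mathbb R\cdot 1)$ onto the vertical line $\tilde v+\mathbb R\cdot 1$, and each horizontal hyperplane $\{\bar u=c\}$ of $B^1$ onto the horizontal hyperplane $\{\bar v=c\}$ of $B^0$. -/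

import Mathlib

open MeasureTheory Set
open scoped ContDiff Manifold

noncomputable section

/-! ### The nonlinearity

The circle `𝕊¹ = ℝ / ℤ` is `UnitAddCircle`; its measure `volume` has total mass `1`. -/

/-- `f : 𝕊¹ × ℝ → ℝ` is smooth: its lift to `ℝ × ℝ` (which is `1`-periodic in the first variable)
is of class `C^∞`. -/
def IsSmoothNonlinearity (f : UnitAddCircle → ℝ → ℝ) : Prop :=
  ContDiff ℝ ∞ (fun p : ℝ × ℝ => f (p.1 : UnitAddCircle) p.2)

/-- For an interval `I`, the two integrals
`∫_I ds / max(1, sup_t f(t,s))` and `∫_I ds / max(1, sup_t (-f(t,s)))` are both finite. -/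
def IsWildOn (f : UnitAddCircle → ℝ → ℝ) (I : Set ℝ) : Prop :=
  (∫⁻ s in I, ENNReal.ofReal (1 / max 1 (⨆ t, f t s))) < ⊤ ∧
  (∫⁻ s in I, ENNReal.ofReal (1 / max 1 (⨆ t, -f t s))) < ⊤

/-- `f` is tame if it is neither wild at `+∞` nor wild at `-∞`. -/
def IsTame (f : UnitAddCircle → ℝ → ℝ) : Prop :=
  ¬ IsWildOn f (Ici 0) ∧ ¬ IsWildOn f (Iic 0)

theorem IsSmoothNonlinearity.continuous {f : UnitAddCircle → ℝ → ℝ}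
    (hf : IsSmoothNonlinearity f) : Continuous (fun p : UnitAddCircle × ℝ => f p.1 p.2) := by
  have hq : IsOpenQuotientMap
      (Prod.map (fun x : ℝ => (x : UnitAddCircle)) (id : ℝ → ℝ)) :=
    IsOpenQuotientMap.prodMap QuotientAddGroup.isOpenQuotientMap_mk IsOpenQuotientMap.id
  exact hq.isQuotientMap.continuous_iff.2 (ContDiff.continuous hf)

/-- The continuous function `t ↦ f(t, u(t))`, for `u` continuous. -/
def nemytskii (f : UnitAddCircle → ℝ → ℝ) (hf : IsSmoothNonlinearity f)
    (u : C(UnitAddCircle, ℝ)) : C(UnitAddCircle, ℝ) where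
  toFun t := f t (u t)
  continuous_toFun := hf.continuous.comp (continuous_id.prodMk u.continuous)

/-! ### Splitting a space of functions into average-zero functions and constants -/

/-- An average functional on a space `B`, and the constant function `1` in `B`. -/
structure MeanSplitting (B : Type*) [AddCommGroup B] [Module ℝ B] where
  avg : B →ₗ[ℝ] ℝ
  one : B
  avg_one : avg one = 1

namespace MeanSplitting

variable {B : Type*} [AddCommGroup B] [Module ℝ B]

/-- The average-zero part `ũ = u - ∫ u`. -/
def tilde (S : MeanSplitting B) (u : B) : B := u - S.avg u • S.one

/-- The subspace of functions of average zero. -/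
def zeroMean (S : MeanSplitting B) : Submodule ℝ B := LinearMap.ker S.avg

/-- The subspace of constant functions. -/
def constants (S : MeanSplitting B) : Submodule ℝ B := Submodule.span ℝ {S.one}

/-- The horizontal hyperplane of functions of average `c`. -/
def horizontal (S : MeanSplitting B) (c : ℝ) : Set B := {u | S.avg u = c}

/-- The vertical line `{v + r | r ∈ ℝ}` through `v`. -/
def vertical (S : MeanSplitting B) (v : B) : Set B := {w | ∃ r : ℝ, w = v + r • S.one}

end MeanSplitting

/-! ### The `C` case -/

/-- `C⁰(𝕊¹; ℝ)` with the supremum norm. -/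
abbrev C0 : Type := C(UnitAddCircle, ℝ)

/-- `C¹(𝕊¹; ℝ)`, as the graph of the derivative: the pairs `(u, u')` of continuous functions on the
circle, the second being the derivative of the first, with norm `max (‖u‖_∞) (‖u'‖_∞)`. -/
def C1 : Submodule ℝ (C0 × C0) where
  carrier := {p | ∀ x : ℝ, HasDerivAt (fun y : ℝ => p.1 (y : UnitAddCircle))
    (p.2 (x : UnitAddCircle)) x}
  add_mem' {p q} hp hq x := by simpa using! (hp x).add (hq x)
  zero_mem' x := by simpa using! hasDerivAt_const x (0 : ℝ)
  smul_mem' c p hp x := by simpa using! (hp x).const_smul c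

/-- The average on `C⁰`. -/
def meanC0 : MeanSplitting C0 where
  avg :=
    { toFun := fun v => ∫ t, v t
      map_add' := fun v w =>
        integral_add (v.continuous.integrable_of_hasCompactSupport (HasCompactSupport.of_compactSpace _))
          (w.continuous.integrable_of_hasCompactSupport (HasCompactSupport.of_compactSpace _))
      map_smul' := fun c v => integral_const_mul c v }
  one := 1
  avg_one := by
    change ∫ _ : UnitAddCircle, (1 : ℝ) = 1
    simp [Measure.real]

/-- The average on `C¹`. -/
def meanC1 : MeanSplitting C1 where
  avg := meanC0.avg ∘ₗ LinearMap.fst ℝ C0 C0 ∘ₗ C1.subtype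
  one := ⟨(1, 0), fun x => by simpa using! hasDerivAt_const x (1 : ℝ)⟩
  avg_one := meanC0.avg_one

/-- The operator `F(u) = u' + f(t, u)` from `C¹` to `C⁰`. -/
def operatorC (f : UnitAddCircle → ℝ → ℝ) (hf : IsSmoothNonlinearity f) (u : C1) : C0 :=
  u.1.2 + nemytskii f hf u.1.1

/-! ### The `H` case -/

/-- `L²(𝕊¹; ℝ)`. -/
abbrev L2 : Type := Lp ℝ 2 (volume : Measure UnitAddCircle)

/-- `w` is (the continuous representative of) an absolutely continuous function on the circle which
is almost everywhere equal to `u`, and whose almost everywhere derivative is `g`. -/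
def IsACRep (w : C0) (u g : L2) : Prop :=
  (u : UnitAddCircle → ℝ) =ᵐ[volume] w ∧
  AbsolutelyContinuousOnInterval (fun x : ℝ => w (x : UnitAddCircle)) 0 1 ∧
  ∀ᵐ (x : ℝ) ∂(volume.restrict (Ioc (0 : ℝ) 1)),
    HasDerivAt (fun y : ℝ => w (y : UnitAddCircle)) (g (x : UnitAddCircle)) x

theorem ae_circle_lift {P : UnitAddCircle → Prop} (h : ∀ᵐ t, P t) :
    ∀ᵐ (x : ℝ) ∂(volume.restrict (Ioc (0 : ℝ) 1)), P (x : UnitAddCircle) := by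
  have := (UnitAddCircle.measurePreserving_mk 0).quasiMeasurePreserving.ae h
  simpa using! this

theorem IsACRep.add {w₁ w₂ : C0} {u₁ u₂ g₁ g₂ : L2} (h₁ : IsACRep w₁ u₁ g₁)
    (h₂ : IsACRep w₂ u₂ g₂) : IsACRep (w₁ + w₂) (u₁ + u₂) (g₁ + g₂) := by
  refine ⟨?_, by simpa using! h₁.2.1.add h₂.2.1, ?_⟩
  · filter_upwards [h₁.1, h₂.1, Lp.coeFn_add u₁ u₂] with t a b c
    rw [c, Pi.add_apply, a, b]
    rfl
  · filter_upwards [h₁.2.2, h₂.2.2, ae_circle_lift (Lp.coeFn_add g₁ g₂)] with t a b c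
    rw [c]
    simpa using! a.add b

theorem IsACRep.smul {w : C0} {u g : L2} (c : ℝ) (h : IsACRep w u g) :
    IsACRep (c • w) (c • u) (c • g) := by
  refine ⟨?_, by simpa using! h.2.1.const_smul c, ?_⟩
  · filter_upwards [h.1, Lp.coeFn_smul c u] with t a b
    rw [b, Pi.smul_apply, a]
    rfl
  · filter_upwards [h.2.2, ae_circle_lift (Lp.coeFn_smul c g)] with t a b
    rw [b]
    simpa using! a.const_smul c

theorem IsACRep.const (c : ℝ) :
    IsACRep (ContinuousMap.const _ c) (ContinuousMap.toLp 2 volume ℝ (ContinuousMap.const _ c))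
      0 := by
  refine ⟨ContinuousMap.coeFn_toLp _ _, ?_, ?_⟩
  · exact (contDiff_const (c := c)).contDiffOn.absolutelyContinuousOnInterval
  · filter_upwards [ae_circle_lift (Lp.coeFn_zero ℝ 2 (volume : Measure UnitAddCircle))] with x hx
    rw [hx]
    exact hasDerivAt_const x c

/-- `H¹(𝕊¹; ℝ)`, the periodic absolutely continuous functions with derivative in `L²`, as the graph
of the derivative: the pairs `(u, u')` in `L² × L²`, with the Hilbert norm
`(‖u‖² + ‖u'‖²)^(1/2)`. -/
def H1 : Submodule ℝ (WithLp 2 (L2 × L2)) where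
  carrier := {p | ∃ w : C0, IsACRep w p.fst p.snd}
  add_mem' := by
    rintro p q ⟨w, hw⟩ ⟨z, hz⟩
    exact ⟨w + z, hw.add hz⟩
  zero_mem' := by
    refine ⟨ContinuousMap.const _ 0, ?_⟩
    have h := IsACRep.const 0
    have e : ContinuousMap.const UnitAddCircle (0 : ℝ) = 0 := rfl
    rw [e, map_zero] at h
    exact h
  smul_mem' := by
    rintro c p ⟨w, hw⟩
    exact ⟨c • w, hw.smul c⟩

/-- The continuous representative of an element of `H¹` (it is unique). -/
def H1rep (u : H1) : C0 := Classical.choose u.2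

theorem H1rep_spec (u : H1) : IsACRep (H1rep u) u.1.fst u.1.snd := Classical.choose_spec u.2

/-- The average on `L²`. -/
def meanL2 : MeanSplitting L2 where
  avg :=
    { toFun := fun v => ∫ t, v t
      map_add' := fun v w => by
        rw [integral_congr_ae (Lp.coeFn_add v w)]
        exact integral_add ((Lp.memLp v).integrable one_le_two) ((Lp.memLp w).integrable one_le_two)
      map_smul' := fun c v => by
        rw [integral_congr_ae (Lp.coeFn_smul c v)]
        exact integral_const_mul c v }
  one := ContinuousMap.toLp 2 volume ℝ (ContinuousMap.const _ 1)
  avg_one := by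
    change ∫ t, (ContinuousMap.toLp 2 volume ℝ (ContinuousMap.const UnitAddCircle (1 : ℝ))) t = 1
    rw [integral_congr_ae (ContinuousMap.coeFn_toLp _ _)]
    simp [Measure.real]

/-- The average on `H¹`. -/
def meanH1 : MeanSplitting H1 where
  avg :=
    { toFun := fun u => meanL2.avg u.1.fst
      map_add' := fun u v => map_add meanL2.avg u.1.fst v.1.fst
      map_smul' := fun c u => map_smul meanL2.avg c u.1.fst }
  one := ⟨WithLp.toLp 2 (meanL2.one, 0), ⟨ContinuousMap.const _ 1, IsACRep.const 1⟩⟩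
  avg_one := meanL2.avg_one

/-- The operator `F(u) = u' + f(t, u)` from `H¹` to `L²`. -/
def operatorH (f : UnitAddCircle → ℝ → ℝ) (hf : IsSmoothNonlinearity f) (u : H1) : L2 :=
  u.1.snd + ContinuousMap.toLp 2 volume ℝ (nemytskii f hf (H1rep u))

/-! ### Global adapted coordinates -/

/-- The map `u ↦ ṽ + ū`, where `u = ũ + ū` and `F u = ṽ + v̄`. -/
def adaptedMap {B₁ B₀ : Type*} [AddCommGroup B₁] [Module ℝ B₁] [AddCommGroup B₀] [Module ℝ B₀]
    (S₁ : MeanSplitting B₁) (S₀ : MeanSplitting B₀) (F : B₁ → B₀) (u : B₁) : B₀ :=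
  S₀.tilde (F u) + S₁.avg u • S₀.one

/-- `Ψ = adaptedMap S₁ S₀ F` is a global smooth diffeomorphism, together with the geometric content
of this fact for `F`. -/
def HasGlobalAdaptedCoordinates {B₁ B₀ : Type*}
    [NormedAddCommGroup B₁] [NormedSpace ℝ B₁] [NormedAddCommGroup B₀] [NormedSpace ℝ B₀]
    (S₁ : MeanSplitting B₁) (S₀ : MeanSplitting B₀) (F : B₁ → B₀) : Prop :=
  ∃ Ψ : Diffeomorph 𝓘(ℝ, B₁) 𝓘(ℝ, B₀) B₁ B₀ ∞,
    (∀ u, Ψ u = adaptedMap S₁ S₀ F u) ∧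
    -- adapted coordinates: `F ∘ Ψ⁻¹` is `(ṽ, ū) ↦ (ṽ, φ(ṽ, ū))` with `φ` smooth
    (∃ φ : B₀ → ℝ, ContDiff ℝ ∞ φ ∧ ∀ v ∈ S₀.zeroMean, ∀ a : ℝ,
      F (Ψ.symm (v + a • S₀.one)) = v + φ (v + a • S₀.one) • S₀.one) ∧
    -- for each average `c`, the map `ũ ↦ ṽ` is a diffeomorphism
    (∀ c : ℝ, ∃ D : Diffeomorph 𝓘(ℝ, S₁.zeroMean) 𝓘(ℝ, S₀.zeroMean) S₁.zeroMean S₀.zeroMean ∞,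
      ∀ u : S₁.zeroMean, (D u : B₀) = S₀.tilde (F (u + c • S₁.one))) ∧
    -- sheets: `F` maps horizontal hyperplanes injectively onto smooth graphs over the average-zero
    -- functions, transversal to the vertical lines
    (∀ c : ℝ, InjOn F (S₁.horizontal c) ∧
      (∃ ψ : S₀.zeroMean → ℝ, ContDiff ℝ ∞ ψ ∧
        F '' S₁.horizontal c = {w | ∃ v : S₀.zeroMean, w = v + ψ v • S₀.one}) ∧
      ∀ u ∈ S₁.horizontal c,
        IsCompl (S₁.zeroMean.map (fderiv ℝ F u).toLinearMap) S₀.constants) ∧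
    -- fibres: the preimage of each vertical line is a smooth curve, meeting each horizontal
    -- hyperplane exactly once and transversally
    (∀ v ∈ S₀.zeroMean, ∃ γ : ℝ → B₁, ContDiff ℝ ∞ γ ∧
      range γ = F ⁻¹' S₀.vertical v ∧
      (∀ c : ℝ, F ⁻¹' S₀.vertical v ∩ S₁.horizontal c = {γ c}) ∧
      ∀ c : ℝ, IsCompl (Submodule.span ℝ {deriv γ c}) S₁.zeroMean) ∧
    -- foliation: `Ψ` straightens the fibres to the vertical lines, and preserves averages
    (∀ v ∈ S₀.zeroMean, Ψ '' (F ⁻¹' S₀.vertical v) = S₀.vertical v) ∧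
    (∀ c : ℝ, Ψ '' S₁.horizontal c = S₀.horizontal c)

end

/-!
In the variable `w = u' + ū`, which determines `u`, the map `Ψ` becomes `w ↦ w + K w`, where `K w`
is the average-zero part of `f(t, u)`; the map `K` is compact, since `u` is a primitive of the
average-zero part of `w`. The map `Ψ` is

* injective, as are its derivatives: the difference `k` of two solutions has average zero and
  satisfies `k' = g - μ` with `|g| ≤ L |k|` and `μ` constant; comparing the signs of `k'` at zeros
  of `k` gives `μ = 0`, and then `k = 0` by Grönwall;
* a local diffeomorphism, by the Fredholm alternative;
* of closed range, by compactness and an a priori bound: if the integral of `1 / max(1, sup_t (-f))`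
  diverges at `+∞`, then a bound on `u' + f(t, u)` in `L¹` prevents `u` from rising far within one
  period. The divergence for `f` gives the same after reversing `t`, and `-∞` is treated by
  replacing `u` with `-u`.

Since `Ψ` preserves averages and `F` differs from it by a constant function, the geometric
statements are then formal.
-/

noncomputable section

/-! ### Geometry of an invertible adapted map -/

namespace MeanSplitting

section Algebra

variable {B : Type*} [AddCommGroup B] [Module ℝ B] (S : MeanSplitting B)

theorem mem_zeroMean {u : B} : u ∈ S.zeroMean ↔ S.avg u = 0 := Iff.rfl

theorem mem_horizontal {u : B} {c : ℝ} : u ∈ S.horizontal c ↔ S.avg u = c := Iff.rfl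

@[simp] theorem avg_tilde (u : B) : S.avg (S.tilde u) = 0 := by
  simp [tilde, S.avg_one]

theorem tilde_mem_zeroMean (u : B) : S.tilde u ∈ S.zeroMean := S.avg_tilde u

theorem tilde_add_avg_smul_one (u : B) : S.tilde u + S.avg u • S.one = u :=
  sub_add_cancel u _

theorem tilde_add_smul_one (v : B) (a : ℝ) : S.tilde (v + a • S.one) = S.tilde v := by
  simp only [tilde, map_add, map_smul, S.avg_one, smul_eq_mul, mul_one, add_smul]
  abel

variable {S}

theorem tilde_of_mem_zeroMean {v : B} (hv : v ∈ S.zeroMean) : S.tilde v = v := by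
  simp [tilde, S.mem_zeroMean.1 hv]

theorem tilde_add_smul_one_of_mem_zeroMean {v : B} (hv : v ∈ S.zeroMean) (a : ℝ) :
    S.tilde (v + a • S.one) = v := by
  rw [tilde_add_smul_one, tilde_of_mem_zeroMean hv]

theorem avg_add_smul_one_of_mem_zeroMean {v : B} (hv : v ∈ S.zeroMean) (a : ℝ) :
    S.avg (v + a • S.one) = a := by
  simp [S.avg_one, S.mem_zeroMean.1 hv]

theorem mem_vertical_iff {v w : B} (hv : v ∈ S.zeroMean) : w ∈ S.vertical v ↔ S.tilde w = v := by
  constructor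
  · rintro ⟨r, rfl⟩
    exact tilde_add_smul_one_of_mem_zeroMean hv r
  · rintro rfl
    exact ⟨S.avg w, (S.tilde_add_avg_smul_one w).symm⟩

theorem isCompl_span_zeroMean {x : B} (hx : S.avg x ≠ 0) :
    IsCompl (Submodule.span ℝ {x}) S.zeroMean :=
  have hsurj : Function.Surjective S.avg := LinearMap.surjective fun h => hx (by simp [h])
  (Submodule.isCompl_span_singleton_of_isCoatom_of_notMem
    (LinearMap.isCoatom_ker_of_surjective hsurj) hx).symm

end Algebra

section Continuity

variable {B : Type*} [NormedAddCommGroup B] [NormedSpace ℝ B] (S : MeanSplitting B)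

/-- The average as a continuous functional. -/
def avgL (h : Continuous S.avg) : B →L[ℝ] ℝ := ⟨S.avg, h⟩

/-- The projection `u ↦ ũ` as a continuous linear map. -/
def tildeL (h : Continuous S.avg) : B →L[ℝ] B :=
  ContinuousLinearMap.id ℝ B - (S.avgL h).smulRight S.one

@[simp] theorem tildeL_apply (h : Continuous S.avg) (u : B) : S.tildeL h u = S.tilde u := rfl

/-- The projection `u ↦ ũ` with values in the subspace of functions of average zero. -/
def projL (h : Continuous S.avg) : B →L[ℝ] S.zeroMean :=
  (S.tildeL h).codRestrict S.zeroMean S.tilde_mem_zeroMean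

@[simp] theorem coe_projL (h : Continuous S.avg) (u : B) : (S.projL h u : B) = S.tilde u := rfl

end Continuity

end MeanSplitting

section AdaptedMap

open MeanSplitting

variable {B₁ B₀ : Type*} [AddCommGroup B₁] [Module ℝ B₁] [AddCommGroup B₀] [Module ℝ B₀]
  {S₁ : MeanSplitting B₁} {S₀ : MeanSplitting B₀} {F : B₁ → B₀}

theorem avg_adaptedMap (u : B₁) : S₀.avg (adaptedMap S₁ S₀ F u) = S₁.avg u :=
  avg_add_smul_one_of_mem_zeroMean (S₀.tilde_mem_zeroMean _) _

theorem tilde_adaptedMap (u : B₁) : S₀.tilde (adaptedMap S₁ S₀ F u) = S₀.tilde (F u) :=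
  tilde_add_smul_one_of_mem_zeroMean (S₀.tilde_mem_zeroMean _) _

theorem adaptedMap_eq_add_smul_one_iff {v : B₀} (hv : v ∈ S₀.zeroMean) {u : B₁} {c : ℝ} :
    adaptedMap S₁ S₀ F u = v + c • S₀.one ↔ F u ∈ S₀.vertical v ∧ u ∈ S₁.horizontal c := by
  rw [mem_vertical_iff hv, ← tilde_adaptedMap (S₁ := S₁), mem_horizontal,
    ← avg_adaptedMap (S₀ := S₀) (F := F)]
  constructor
  · intro h
    rw [h, tilde_add_smul_one_of_mem_zeroMean hv, avg_add_smul_one_of_mem_zeroMean hv]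
    exact ⟨rfl, rfl⟩
  · rintro ⟨rfl, rfl⟩
    exact (S₀.tilde_add_avg_smul_one _).symm

theorem injOn_horizontal_of_injective_adaptedMap
    (h : Function.Injective (adaptedMap S₁ S₀ F)) (c : ℝ) : InjOn F (S₁.horizontal c) := by
  rintro u (rfl : S₁.avg u = _) w (hw : S₁.avg w = _) hF
  exact h (by rw [adaptedMap, adaptedMap, hF, hw])

theorem isCompl_map_zeroMean_constants {A : B₁ →ₗ[ℝ] B₀}
    (hA : Function.Bijective (adaptedMap S₁ S₀ A)) :
    IsCompl (S₁.zeroMean.map A) S₀.constants := by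
  constructor
  · rw [Submodule.disjoint_def]
    rintro _ ⟨h, hh, rfl⟩ hc
    obtain ⟨r, hr⟩ := Submodule.mem_span_singleton.1 hc
    have hAh : adaptedMap S₁ S₀ A h = adaptedMap S₁ S₀ A 0 := by
      simp [adaptedMap, ← hr, S₁.mem_zeroMean.1 hh, tilde, S₀.avg_one]
    rw [hA.1 hAh, map_zero]
  · rw [codisjoint_iff, Submodule.eq_top_iff']
    intro w
    obtain ⟨h, hh⟩ := hA.2 (S₀.tilde w + (0 : ℝ) • S₀.one)
    obtain ⟨⟨r, hr⟩, h0⟩ := (adaptedMap_eq_add_smul_one_iff (S₀.tilde_mem_zeroMean w)).1 hh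
    refine Submodule.mem_sup.2 ⟨A h, ⟨h, h0, rfl⟩, (S₀.avg w - r) • S₀.one,
      Submodule.smul_mem _ _ (Submodule.mem_span_singleton_self _), ?_⟩
    calc A h + (S₀.avg w - r) • S₀.one = S₀.tilde w + S₀.avg w • S₀.one := by
          rw [hr, sub_smul]
          abel
      _ = w := S₀.tilde_add_avg_smul_one w

variable {Ψ : B₁ ≃ B₀} (hΨ : ∀ u, Ψ u = adaptedMap S₁ S₀ F u) {v : B₀} (hv : v ∈ S₀.zeroMean)

include hΨ hv

theorem symm_eq_iff_of_adaptedMap {u : B₁} {c : ℝ} :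
    Ψ.symm (v + c • S₀.one) = u ↔ F u ∈ S₀.vertical v ∧ u ∈ S₁.horizontal c := by
  rw [Equiv.symm_apply_eq, eq_comm, hΨ, adaptedMap_eq_add_smul_one_iff hv]

theorem symm_mem_of_adaptedMap (c : ℝ) : F (Ψ.symm (v + c • S₀.one)) ∈ S₀.vertical v ∧
    Ψ.symm (v + c • S₀.one) ∈ S₁.horizontal c :=
  (symm_eq_iff_of_adaptedMap hΨ hv).1 rfl

theorem apply_symm_of_adaptedMap (c : ℝ) : F (Ψ.symm (v + c • S₀.one)) =
    v + S₀.avg (F (Ψ.symm (v + c • S₀.one))) • S₀.one := by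
  conv_lhs => rw [← S₀.tilde_add_avg_smul_one (F _),
    (mem_vertical_iff hv).1 (symm_mem_of_adaptedMap hΨ hv c).1]

theorem preimage_vertical_inter_horizontal (c : ℝ) :
    F ⁻¹' S₀.vertical v ∩ S₁.horizontal c = {Ψ.symm (v + c • S₀.one)} := by
  ext u
  rw [mem_singleton_iff, eq_comm, symm_eq_iff_of_adaptedMap hΨ hv]
  rfl

theorem range_symm_add_smul_one :
    range (fun c : ℝ => Ψ.symm (v + c • S₀.one)) = F ⁻¹' S₀.vertical v := by
  ext u
  constructor
  · rintro ⟨c, rfl⟩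
    exact (symm_mem_of_adaptedMap hΨ hv c).1
  · exact fun hu => ⟨S₁.avg u, (symm_eq_iff_of_adaptedMap hΨ hv).2 ⟨hu, rfl⟩⟩

theorem image_preimage_vertical : Ψ '' (F ⁻¹' S₀.vertical v) = S₀.vertical v := by
  rw [← range_symm_add_smul_one hΨ hv, ← range_comp]
  ext w
  simp [vertical, eq_comm]

omit hv

theorem image_horizontal_eq_graph (c : ℝ) : F '' S₁.horizontal c = {w | ∃ v : S₀.zeroMean,
    w = v + S₀.avg (F (Ψ.symm (v + c • S₀.one))) • S₀.one} := by
  ext w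
  constructor
  · rintro ⟨u, hu, rfl⟩
    refine ⟨⟨_, S₀.tilde_mem_zeroMean (F u)⟩, ?_⟩
    have hsymm : Ψ.symm (S₀.tilde (F u) + c • S₀.one) = u :=
      (symm_eq_iff_of_adaptedMap hΨ (S₀.tilde_mem_zeroMean _)).2
        ⟨(mem_vertical_iff (S₀.tilde_mem_zeroMean _)).2 rfl, hu⟩
    simp only [hsymm, S₀.tilde_add_avg_smul_one]
  · rintro ⟨v, rfl⟩
    exact ⟨_, (symm_mem_of_adaptedMap hΨ v.2 c).2, apply_symm_of_adaptedMap hΨ v.2 c⟩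

theorem image_horizontal (c : ℝ) : Ψ '' S₁.horizontal c = S₀.horizontal c := by
  have hpre : S₁.horizontal c = Ψ ⁻¹' S₀.horizontal c := by
    ext u
    rw [mem_preimage, mem_horizontal, mem_horizontal, hΨ, avg_adaptedMap]
  rw [hpre, image_preimage_eq _ Ψ.surjective]

end AdaptedMap

section Diffeomorphism

open MeanSplitting

variable {B₁ B₀ : Type*} [NormedAddCommGroup B₁] [NormedSpace ℝ B₁] [NormedAddCommGroup B₀]
  [NormedSpace ℝ B₀] {S₁ : MeanSplitting B₁} {S₀ : MeanSplitting B₀}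

theorem tilde_apply_add_smul_one {Ψ : B₁ → B₀} (hΨ : ∀ u, S₀.avg (Ψ u) = S₁.avg u) {u : B₁}
    (hu : u ∈ S₁.zeroMean) (c : ℝ) :
    S₀.tilde (Ψ (u + c • S₁.one)) + c • S₀.one = Ψ (u + c • S₁.one) := by
  conv_rhs => rw [← S₀.tilde_add_avg_smul_one (Ψ _), hΨ, avg_add_smul_one_of_mem_zeroMean hu]

theorem contDiff_projL_apply_add_smul_one (h₀ : Continuous S₀.avg) {Ψ : B₁ → B₀}
    (hΨ : ContDiff ℝ ∞ Ψ) (c : ℝ) :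
    ContDiff ℝ ∞ fun u : S₁.zeroMean => S₀.projL h₀ (Ψ (u + c • S₁.one)) :=
  (S₀.projL h₀).contDiff.comp (hΨ.comp (S₁.zeroMean.subtypeL.contDiff.add contDiff_const))

/-- The diffeomorphism between the spaces of average-zero functions induced by the restriction of
an average-preserving diffeomorphism to the horizontal hyperplane of functions of average `c`. -/
def sliceDiffeomorph (h₁ : Continuous S₁.avg) (h₀ : Continuous S₀.avg)
    (Ψ : Diffeomorph 𝓘(ℝ, B₁) 𝓘(ℝ, B₀) B₁ B₀ ∞) (hΨ : ∀ u, S₀.avg (Ψ u) = S₁.avg u) (c : ℝ) :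
    Diffeomorph 𝓘(ℝ, S₁.zeroMean) 𝓘(ℝ, S₀.zeroMean) S₁.zeroMean S₀.zeroMean ∞ where
  toFun u := S₀.projL h₀ (Ψ (u + c • S₁.one))
  invFun v := S₁.projL h₁ (Ψ.symm (v + c • S₀.one))
  left_inv u := Subtype.ext <| by
    rw [coe_projL, coe_projL, tilde_apply_add_smul_one hΨ u.2, Ψ.symm_apply_apply,
      tilde_add_smul_one_of_mem_zeroMean u.2]
  right_inv v := Subtype.ext <| by
    have hsymm (w : B₀) : S₁.avg (Ψ.symm w) = S₀.avg w := by rw [← hΨ, Ψ.apply_symm_apply]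
    rw [coe_projL, coe_projL, tilde_apply_add_smul_one hsymm v.2, Ψ.apply_symm_apply,
      tilde_add_smul_one_of_mem_zeroMean v.2]
  contMDiff_toFun := (contDiff_projL_apply_add_smul_one h₀ Ψ.contMDiff.contDiff c).contMDiff
  contMDiff_invFun :=
    (contDiff_projL_apply_add_smul_one h₁ Ψ.symm.contMDiff.contDiff c).contMDiff

theorem coe_sliceDiffeomorph_apply (h₁ : Continuous S₁.avg) (h₀ : Continuous S₀.avg)
    (Ψ : Diffeomorph 𝓘(ℝ, B₁) 𝓘(ℝ, B₀) B₁ B₀ ∞) (hΨ : ∀ u, S₀.avg (Ψ u) = S₁.avg u) (c : ℝ)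
    (u : S₁.zeroMean) :
    (sliceDiffeomorph h₁ h₀ Ψ hΨ c u : B₀) = S₀.tilde (Ψ (u + c • S₁.one)) := rfl

theorem bijective_fderiv_diffeomorph (Ψ : Diffeomorph 𝓘(ℝ, B₁) 𝓘(ℝ, B₀) B₁ B₀ ∞) (u : B₁) :
    Function.Bijective (fderiv ℝ Ψ u) := by
  rw [← mfderiv_eq_fderiv]
  exact (Ψ.mfderivToContinuousLinearEquiv (by simp) (x := u)).bijective

variable {F : B₁ → B₀}

theorem hasFDerivAt_adaptedMap (h₁ : Continuous S₁.avg) (h₀ : Continuous S₀.avg) {u : B₁}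
    {F' : B₁ →L[ℝ] B₀} (hF : HasFDerivAt F F' u) :
    HasFDerivAt (adaptedMap S₁ S₀ F)
      (S₀.tildeL h₀ ∘L F' + (S₁.avgL h₁).smulRight S₀.one) u :=
  ((S₀.tildeL h₀).hasFDerivAt.comp u hF).add ((S₁.avgL h₁).smulRight S₀.one).hasFDerivAt

theorem bijective_adaptedMap_fderiv (h₁ : Continuous S₁.avg) (h₀ : Continuous S₀.avg)
    {Ψ : Diffeomorph 𝓘(ℝ, B₁) 𝓘(ℝ, B₀) B₁ B₀ ∞} (hΨ : ∀ u, Ψ u = adaptedMap S₁ S₀ F u) {u : B₁}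
    (hF : DifferentiableAt ℝ F u) :
    Function.Bijective (adaptedMap S₁ S₀ (fderiv ℝ F u)) := by
  have hderiv := (hasFDerivAt_adaptedMap h₁ h₀ hF.hasFDerivAt).fderiv
  have hbij := bijective_fderiv_diffeomorph Ψ u
  rw [show (Ψ : B₁ → B₀) = adaptedMap S₁ S₀ F from funext hΨ, hderiv] at hbij
  exact hbij

theorem avg_deriv_eq_one (h₁ : Continuous S₁.avg) {γ : ℝ → B₁} (hγ : Differentiable ℝ γ)
    (havg : ∀ c, S₁.avg (γ c) = c) (c : ℝ) : S₁.avg (deriv γ c) = 1 := by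
  have hderiv : HasDerivAt (fun c => S₁.avg (γ c)) (S₁.avg (deriv γ c)) c :=
    (S₁.avgL h₁).hasFDerivAt.comp_hasDerivAt c (hγ c).hasDerivAt
  simp only [havg] at hderiv
  exact hderiv.unique (hasDerivAt_id c)

theorem hasGlobalAdaptedCoordinates_of_diffeomorph (h₁ : Continuous S₁.avg)
    (h₀ : Continuous S₀.avg) (hF : ContDiff ℝ ∞ F)
    (Ψ : Diffeomorph 𝓘(ℝ, B₁) 𝓘(ℝ, B₀) B₁ B₀ ∞) (hΨ : ∀ u, Ψ u = adaptedMap S₁ S₀ F u) :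
    HasGlobalAdaptedCoordinates S₁ S₀ F := by
  have hinj : Function.Injective (adaptedMap S₁ S₀ F) := by
    rw [← show (Ψ : B₁ → B₀) = adaptedMap S₁ S₀ F from funext hΨ]
    exact Ψ.injective
  have havg (u : B₁) : S₀.avg (Ψ u) = S₁.avg u := by rw [hΨ, avg_adaptedMap]
  have hsymm : ContDiff ℝ ∞ Ψ.symm := Ψ.symm.contMDiff.contDiff
  have hφ : ContDiff ℝ ∞ fun z => S₀.avg (F (Ψ.symm z)) :=
    (S₀.avgL h₀).contDiff.comp (hF.comp hsymm)
  have hγ (v : B₀) : ContDiff ℝ ∞ fun c : ℝ => Ψ.symm (v + c • S₀.one) :=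
    hsymm.comp (contDiff_const.add (contDiff_id.smul contDiff_const))
  refine ⟨Ψ, hΨ,
    ⟨fun z => S₀.avg (F (Ψ.symm z)), hφ,
      fun v hv a => apply_symm_of_adaptedMap (Ψ := Ψ.toEquiv) hΨ hv a⟩,
    fun c => ⟨sliceDiffeomorph h₁ h₀ Ψ havg c, fun u => by
      rw [coe_sliceDiffeomorph_apply, hΨ, tilde_adaptedMap]⟩,
    fun c => ⟨injOn_horizontal_of_injective_adaptedMap hinj c,
      ⟨fun v => S₀.avg (F (Ψ.symm (v + c • S₀.one))),
        hφ.comp (S₀.zeroMean.subtypeL.contDiff.add contDiff_const),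
        image_horizontal_eq_graph (Ψ := Ψ.toEquiv) hΨ c⟩,
      fun u _ => isCompl_map_zeroMean_constants
        (bijective_adaptedMap_fderiv h₁ h₀ hΨ (hF.differentiable (by simp) u))⟩,
    fun v hv => ⟨fun c => Ψ.symm (v + c • S₀.one), hγ v,
      range_symm_add_smul_one (Ψ := Ψ.toEquiv) hΨ hv,
      preimage_vertical_inter_horizontal (Ψ := Ψ.toEquiv) hΨ hv,
      fun c => isCompl_span_zeroMean ?_⟩,
    fun v hv => image_preimage_vertical (Ψ := Ψ.toEquiv) hΨ hv,
    image_horizontal (Ψ := Ψ.toEquiv) hΨ⟩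
  rw [avg_deriv_eq_one h₁ ((hγ v).differentiable (by simp))
    fun c => (symm_mem_of_adaptedMap (Ψ := Ψ.toEquiv) hΨ hv c).2]
  exact one_ne_zero

end Diffeomorphism

/-! ### Smoothness of the superposition operator -/

section Nemytskii

variable {f : UnitAddCircle → ℝ → ℝ}

/-- The derivative `∂f/∂s` of a nonlinearity `f(t, s)`. -/
def stateDeriv (f : UnitAddCircle → ℝ → ℝ) (t : UnitAddCircle) (s : ℝ) : ℝ := deriv (f t) s

theorem IsSmoothNonlinearity.hasDerivAt (hf : IsSmoothNonlinearity f) (t : UnitAddCircle) (s : ℝ) :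
    HasDerivAt (f t) (stateDeriv f t s) s := by
  obtain ⟨x, rfl⟩ := QuotientAddGroup.mk_surjective t
  have h : ContDiff ℝ ∞ (f (x : UnitAddCircle)) :=
    ContDiff.comp (g := fun p : ℝ × ℝ => f (p.1 : UnitAddCircle) p.2) hf (contDiff_prodMk_right x)
  exact (h.differentiable (by simp) s).hasDerivAt

theorem IsSmoothNonlinearity.stateDeriv (hf : IsSmoothNonlinearity f) :
    IsSmoothNonlinearity (stateDeriv f) := by
  set g : ℝ × ℝ → ℝ := fun p => f (p.1 : UnitAddCircle) p.2
  have hg : ContDiff ℝ ∞ g := hf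
  have hpartial (p : ℝ × ℝ) :
      fderiv ℝ g p (0, 1) = _root_.stateDeriv f (p.1 : UnitAddCircle) p.2 := by
    have hslice := (hg.differentiable (by simp) p).hasFDerivAt.comp_hasDerivAt p.2
      ((hasDerivAt_const p.2 p.1).prodMk (hasDerivAt_id p.2))
    exact hslice.unique (hf.hasDerivAt (p.1 : UnitAddCircle) p.2)
  have hcont : ContDiff ℝ ∞ fun p => fderiv ℝ g p (0, 1) :=
    (hg.fderiv_right (by simp)).clm_apply contDiff_const
  simp only [hpartial] at hcont
  exact hcont

theorem continuous_nemytskii (hf : IsSmoothNonlinearity f) : Continuous (nemytskii f hf) :=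
  ContinuousMap.continuous_of_continuous_uncurry _
    (hf.continuous.comp (continuous_snd.prodMk continuous_eval))

theorem exists_forall_abs_add_sub_le (hf : IsSmoothNonlinearity f) (u : C0) {ε : ℝ} (hε : 0 < ε) :
    ∃ δ > 0, ∀ t r, |r| < δ → |f t (u t + r) - f t (u t)| ≤ ε := by
  have hcont : Continuous fun r : ℝ => nemytskii f hf (u + ContinuousMap.const _ r) :=
    (continuous_nemytskii hf).comp (continuous_const.add ContinuousMap.continuous_const')
  obtain ⟨δ, hδ, H⟩ := Metric.continuousAt_iff.1 (hcont.continuousAt (x := 0)) ε hε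
  refine ⟨δ, hδ, fun t r hr => ?_⟩
  have hdist := (ContinuousMap.dist_apply_le_dist t).trans
    (H (x := r) (by rwa [Real.dist_0_eq_abs])).le
  simpa [nemytskii, Real.dist_eq] using hdist

theorem abs_sub_sub_mul_le_of_forall_abs_deriv_sub_le {g g' : ℝ → ℝ} {a c h ε : ℝ}
    (hg : ∀ s, HasDerivAt g (g' s) s) (hε : ∀ r, |r| ≤ |h| → |g' (a + r) - c| ≤ ε) :
    |g (a + h) - g a - c * h| ≤ ε * |h| := by
  have key := (convex_segment a (a + h)).norm_image_sub_le_of_norm_hasDerivWithin_le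
    (f := fun s => g s - c * s) (f' := fun s => g' s - c) (C := ε)
    (fun s _ => ((hg s).sub
      (by simpa using (hasDerivAt_id s).const_mul c)).hasDerivWithinAt)
    (fun s hs => by
      rw [segment_eq_uIcc] at hs
      simpa using hε (s - a) (by simpa using abs_sub_left_of_mem_uIcc hs))
    (left_mem_segment ℝ _ _) (right_mem_segment ℝ _ _)
  rw [add_sub_cancel_left] at key
  calc |g (a + h) - g a - c * h| = |g (a + h) - c * (a + h) - (g a - c * a)| := by ring_nf
    _ ≤ ε * |h| := key

theorem hasFDerivAt_nemytskii (hf : IsSmoothNonlinearity f) (u : C0) :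
    HasFDerivAt (nemytskii f hf)
      (ContinuousLinearMap.mul ℝ C0 (nemytskii (stateDeriv f) hf.stateDeriv u)) u := by
  rw [hasFDerivAt_iff_isLittleO_nhds_zero, Asymptotics.isLittleO_iff]
  intro ε hε
  obtain ⟨δ, hδ, H⟩ := exists_forall_abs_add_sub_le hf.stateDeriv u hε
  filter_upwards [Metric.ball_mem_nhds (0 : C0) hδ] with h hh
  rw [mem_ball_zero_iff] at hh
  rw [ContinuousMap.norm_le _ (by positivity)]
  intro t
  have hht : |h t| ≤ ‖h‖ := h.norm_coe_le_norm t
  calc |f t (u t + h t) - f t (u t) - stateDeriv f t (u t) * h t| ≤ ε * |h t| :=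
        abs_sub_sub_mul_le_of_forall_abs_deriv_sub_le (hf.hasDerivAt t)
          fun r hr => H t r ((hr.trans hht).trans_lt hh)
    _ ≤ ε * ‖h‖ := by gcongr

theorem contDiff_nemytskii (hf : IsSmoothNonlinearity f) : ContDiff ℝ ∞ (nemytskii f hf) := by
  refine contDiff_infty.2 fun n => ?_
  induction n generalizing f with
  | zero => exact contDiff_zero.2 (continuous_nemytskii hf)
  | succ n ih =>
    rw [Nat.cast_succ, contDiff_succ_iff_hasFDerivAt]
    have hmul : ContDiff ℝ n fun v : C0 => ContinuousLinearMap.mul ℝ C0 v :=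
      IsBoundedLinearMap.contDiff (ContinuousLinearMap.isBoundedLinearMap
        (ContinuousLinearMap.mul ℝ C0 : C0 →L[ℝ] C0 →L[ℝ] C0))
    exact ⟨_, hmul.comp (ih hf.stateDeriv), hasFDerivAt_nemytskii hf⟩

end Nemytskii

instance : IsProbabilityMeasure (volume : Measure UnitAddCircle) :=
  ⟨UnitAddCircle.measure_univ⟩

/-! ### A priori bounds -/

section PeriodicFunctions

theorem periodic_lift {α : Type*} (u : UnitAddCircle → α) :
    Function.Periodic (fun x : ℝ => u (x : UnitAddCircle)) 1 := fun x => by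
  simp only [AddCircle.coe_add_period]

theorem exists_eq_and_deriv_nonpos_of_periodic {y y' : ℝ → ℝ} (hp : Function.Periodic y 1)
    (hy : ∀ x, HasDerivAt y (y' x) x) (x₀ : ℝ) : ∃ x, y x = y x₀ ∧ y' x ≤ 0 := by
  by_contra! H
  -- A function increasing through each of its crossings of a level never returns below that level.
  have hle (b : ℝ) (hb : y b = y x₀) : ∀ x ∈ Icc b (b + 1), y x₀ ≤ y x := fun x hx =>
    image_le_of_deriv_right_lt_deriv_boundary (f := fun _ => y x₀) (f' := fun _ => 0)
      continuousOn_const (fun x _ => hasDerivWithinAt_const x _ _) hb.ge hy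
      (fun z _ hz => H z hz.symm) hx
  have hmin : IsLocalMin y x₀ := by
    filter_upwards [Icc_mem_nhds (sub_one_lt x₀) (lt_add_one x₀)] with x hx
    rcases le_total x₀ x with h | h
    · exact hle x₀ rfl x ⟨h, hx.2⟩
    · exact hle (x₀ - 1) (hp.sub_eq x₀) x ⟨hx.1, by linarith⟩
  exact (H x₀ rfl).ne' (hmin.hasDerivAt_eq_zero (hy x₀))

theorem C1.exists_eq_and_deriv_nonpos {p : C0 × C0} (hp : p ∈ C1) (t : UnitAddCircle) :
    ∃ s, p.1 s = p.1 t ∧ p.2 s ≤ 0 := by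
  obtain ⟨x₀, rfl⟩ := QuotientAddGroup.mk_surjective t
  obtain ⟨x, hx⟩ := exists_eq_and_deriv_nonpos_of_periodic (periodic_lift p.1) hp x₀
  exact ⟨x, hx⟩

theorem C1.exists_eq_and_deriv_nonneg {p : C0 × C0} (hp : p ∈ C1) (t : UnitAddCircle) :
    ∃ s, p.1 s = p.1 t ∧ 0 ≤ p.2 s := by
  obtain ⟨s, hs, hs'⟩ := C1.exists_eq_and_deriv_nonpos (neg_mem hp) t
  exact ⟨s, neg_injective hs, neg_nonpos.1 hs'⟩

theorem C0.integrable (u : C0) : Integrable u :=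
  u.continuous.integrable_of_hasCompactSupport (HasCompactSupport.of_compactSpace _)

theorem C0.exists_eq_avg (u : C0) : ∃ t, u t = meanC0.avg u :=
  mem_range_of_exists_le_of_exists_ge u.continuous (exists_le_integral u.integrable)
    (exists_integral_le u.integrable)

/-- Comparing signs of `k'` at zeros of `k` gives `μ = 0`, and then Grönwall applies. -/
theorem C1.eq_zero_of_abs_le {k g : C0} {μ L : ℝ} (hk : (k, g - μ • meanC0.one) ∈ C1)
    (hg : ∀ t, |g t| ≤ L * |k t|) (h0 : meanC0.avg k = 0) : k = 0 := by
  obtain ⟨t₀, ht₀⟩ := C0.exists_eq_avg k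
  rw [h0] at ht₀
  have hμ (t : UnitAddCircle) (h : k t = k t₀) : (g - μ • meanC0.one) t = -μ := by
    have hgt : g t = 0 := by simpa [h, ht₀] using hg t
    simp [hgt, meanC0]
  obtain ⟨s, hs, hs'⟩ := C1.exists_eq_and_deriv_nonpos hk t₀
  obtain ⟨r, hr, hr'⟩ := C1.exists_eq_and_deriv_nonneg hk t₀
  rw [hμ s hs] at hs'
  rw [hμ r hr] at hr'
  obtain rfl : μ = 0 := by linarith
  rw [zero_smul, sub_zero] at hk
  obtain ⟨x₀, rfl⟩ := QuotientAddGroup.mk_surjective t₀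
  ext t
  obtain ⟨x, hx, rfl⟩ := (AddCircle.coe_image_Icc_eq (1 : ℝ) x₀).ge (mem_univ t)
  exact eq_zero_of_abs_deriv_le_mul_abs_self_of_eq_zero_right (K := L)
    (f := fun y : ℝ => k (y : UnitAddCircle)) (fun y _ => (hk y).continuousAt.continuousWithinAt)
    (fun y _ => (hk y).hasDerivWithinAt) ht₀ (fun y _ => hg y) x hx

end PeriodicFunctions

section Barrier

theorem exists_lt_integral_of_lintegral_eq_top {φ : ℝ → ℝ} (hφ : Continuous φ)
    (h0 : ∀ s, 0 ≤ φ s) (hdiv : ∫⁻ s in Ici (0 : ℝ), ENNReal.ofReal (φ s) = ⊤) (M C : ℝ) :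
    ∃ R, M ≤ R ∧ C < ∫ s in M..R, φ s := by
  by_contra! H
  have hIoi : IntegrableOn φ (Ioi M) := by
    refine integrableOn_Ioi_of_intervalIntegral_norm_bounded C M (b := fun R => R)
      (fun R => hφ.integrableOn_Ioc) Filter.tendsto_id ?_
    filter_upwards [Filter.eventually_ge_atTop M] with R hR
    simpa only [Real.norm_eq_abs, abs_of_nonneg (h0 _)] using H R hR
  have hIci : IntegrableOn φ (Ici 0) := (hφ.integrableOn_Icc.union hIoi).mono_set
    fun s hs => (le_or_gt s M).imp (fun h => ⟨hs, h⟩) id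
  exact hIci.lintegral_lt_top.ne hdiv

variable {G : ℝ → ℝ} (hG : Continuous G) (hG1 : ∀ s, 1 ≤ G s)

include hG hG1

theorem continuous_one_div_of_one_le : Continuous fun s => 1 / G s :=
  continuous_const.div hG fun s => (one_pos.trans_le (hG1 s)).ne'

/-- Osgood's argument: the left-hand side grows at the rate `x' b / G (x b) ≤ 1 + |e b|`. -/
theorem integral_one_div_le_of_deriv_le {x x' e : ℝ → ℝ} (he : Continuous e)
    (hx : ∀ t, HasDerivAt x (x' t) t) (hle : ∀ t, x' t ≤ G (x t) + |e t|) {a b : ℝ} (hab : a ≤ b) :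
    ∫ s in x a..x b, 1 / G s ≤ b - a + ∫ t in a..b, |e t| := by
  have hc := continuous_one_div_of_one_le hG hG1
  have hderiv (t : ℝ) : HasDerivAt
      (fun t => t + (∫ r in a..t, |e r|) - ∫ s in x a..x t, 1 / G s)
      (1 + |e t| - 1 / G (x t) * x' t) t :=
    ((hasDerivAt_id t).add (he.abs.integral_hasStrictDerivAt a t).hasDerivAt).sub
      ((hc.integral_hasStrictDerivAt (x a) (x t)).hasDerivAt.comp t (hx t))
  have hmono := monotone_of_deriv_nonneg (fun t => (hderiv t).differentiableAt) fun t => by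
    rw [(hderiv t).deriv, sub_nonneg, one_div_mul_eq_div,
      div_le_iff₀ (one_pos.trans_le (hG1 (x t)))]
    nlinarith [hle t, hG1 (x t), abs_nonneg (e t)]
  have hab := hmono hab
  simp only [intervalIntegral.integral_same] at hab
  linarith

theorem C1.exists_forall_le_of_deriv_le
    (hdiv : ∫⁻ s in Ici (0 : ℝ), ENNReal.ofReal (1 / G s) = ⊤) (M : ℝ) :
    ∃ R, ∀ p ∈ C1, ∀ e : C0, (∀ t, p.2 t ≤ G (p.1 t) + |e t|) → (∃ t, p.1 t ≤ M) →
      ∫ t, |e t| ≤ M → ∀ t, p.1 t ≤ R := by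
  have hc := continuous_one_div_of_one_le hG hG1
  have hpos (s : ℝ) : 0 ≤ 1 / G s := one_div_nonneg.2 (zero_le_one.trans (hG1 s))
  obtain ⟨R, hMR, hR⟩ := exists_lt_integral_of_lintegral_eq_top hc hpos hdiv M (1 + M)
  refine ⟨R, fun p hp e hle ⟨t₀, h0⟩ he t => ?_⟩
  by_contra! hlt
  obtain ⟨a, rfl⟩ := QuotientAddGroup.mk_surjective t₀
  obtain ⟨b, hb, rfl⟩ := (AddCircle.coe_image_Icc_eq (1 : ℝ) a).ge (mem_univ t)
  have he' : Continuous fun x : ℝ => e (x : UnitAddCircle) :=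
    e.continuous.comp (AddCircle.continuous_mk' 1)
  have hunit : ∫ x in a..b, |e (x : UnitAddCircle)| ≤ M := calc
    ∫ x in a..b, |e (x : UnitAddCircle)| ≤ ∫ x in a..a + 1, |e (x : UnitAddCircle)| :=
      intervalIntegral.integral_mono_interval le_rfl hb.1 hb.2
        (Filter.Eventually.of_forall fun _ => abs_nonneg _) (he'.abs.intervalIntegrable _ _)
    _ = ∫ t, |e t| := UnitAddCircle.intervalIntegral_preimage a fun t => |e t|
    _ ≤ M := he
  have hcomparison := integral_one_div_le_of_deriv_le hG hG1 he' hp (fun x => hle x) hb.1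
  have hmono : ∫ s in M..R, 1 / G s ≤
      ∫ s in p.1 (a : UnitAddCircle)..p.1 (b : UnitAddCircle), 1 / G s :=
    intervalIntegral.integral_mono_interval h0 hMR hlt.le
      (Filter.Eventually.of_forall hpos) (hc.intervalIntegrable _ _)
  linarith [hb.2]

omit hG hG1

/-- Composition with the reflection `t ↦ -t` of the circle. -/
def C0.reflect (u : C0) : C0 := u.comp ⟨Neg.neg, continuous_neg⟩

theorem C1.reflect_mem {p : C0 × C0} (hp : p ∈ C1) :
    (C0.reflect p.1, -C0.reflect p.2) ∈ C1 := fun x => by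
  simpa using! (hp (-x)).comp x (hasDerivAt_neg x)

include hG hG1

theorem C1.exists_forall_le_of_neg_deriv_le
    (hdiv : ∫⁻ s in Ici (0 : ℝ), ENNReal.ofReal (1 / G s) = ⊤) (M : ℝ) :
    ∃ R, ∀ p ∈ C1, ∀ e : C0, (∀ t, -p.2 t ≤ G (p.1 t) + |e t|) → (∃ t, p.1 t ≤ M) →
      ∫ t, |e t| ≤ M → ∀ t, p.1 t ≤ R := by
  obtain ⟨R, hR⟩ := C1.exists_forall_le_of_deriv_le hG hG1 hdiv M
  refine ⟨R, fun p hp e hle ⟨t₀, h0⟩ he t => ?_⟩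
  have hint : ∫ t, |C0.reflect e t| = ∫ t, |e t| :=
    integral_neg_eq_self (fun t => |e t|) volume
  simpa [C0.reflect] using hR _ (C1.reflect_mem hp) (C0.reflect e) (fun t => hle (-t))
    ⟨-t₀, by simpa [C0.reflect] using h0⟩ (hint.trans_le he) (-t)

omit hG hG1

variable {f : UnitAddCircle → ℝ → ℝ}

theorem continuous_max_one_iSup (hf : Continuous fun p : UnitAddCircle × ℝ => f p.1 p.2) :
    Continuous fun s => max 1 (⨆ t, f t s) := by
  have hsup := isCompact_univ.continuous_sSup (f := fun (s : ℝ) (t : UnitAddCircle) => f t s)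
    (hf.comp continuous_swap)
  simp only [image_univ] at hsup
  exact continuous_const.max hsup

theorem le_max_one_iSup (hf : Continuous fun p : UnitAddCircle × ℝ => f p.1 p.2)
    (t : UnitAddCircle) (s : ℝ) : f t s ≤ max 1 (⨆ t, f t s) :=
  le_max_of_le_right <| le_ciSup (f := fun t => f t s)
    (isCompact_range (hf.comp (continuous_id.prodMk continuous_const))).bddAbove t

theorem C1.exists_forall_le_of_not_isWildOn_Ici
    (hf : Continuous fun p : UnitAddCircle × ℝ => f p.1 p.2) (hwild : ¬ IsWildOn f (Ici 0))
    (M : ℝ) : ∃ R, ∀ p ∈ C1, (∃ t, p.1 t ≤ M) → ∫ t, |p.2 t + f t (p.1 t)| ≤ M →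
      ∀ t, p.1 t ≤ R := by
  let e (p : C0 × C0) : C0 := ⟨fun t => p.2 t + f t (p.1 t),
    p.2.continuous.add (hf.comp (continuous_id.prodMk p.1.continuous))⟩
  rcases not_and_or.1 hwild with h | h
  · obtain ⟨R, hR⟩ := C1.exists_forall_le_of_neg_deriv_le (continuous_max_one_iSup hf)
      (fun s => le_max_left 1 _) (not_lt_top_iff.1 h) M
    refine ⟨R, fun p hp h0 he => hR p hp (e p) (fun t => ?_) h0 he⟩
    change -p.2 t ≤ _ + |p.2 t + f t (p.1 t)|
    linarith [le_max_one_iSup hf t (p.1 t), neg_abs_le (p.2 t + f t (p.1 t))]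
  · obtain ⟨R, hR⟩ := C1.exists_forall_le_of_deriv_le (continuous_max_one_iSup hf.neg)
      (fun s => le_max_left 1 _) (not_lt_top_iff.1 h) M
    refine ⟨R, fun p hp h0 he => hR p hp (e p) (fun t => ?_) h0 he⟩
    change p.2 t ≤ _ + |p.2 t + f t (p.1 t)|
    linarith [le_max_one_iSup (f := fun t s => -f t s) hf.neg t (p.1 t),
      le_abs_self (p.2 t + f t (p.1 t))]

theorem setLIntegral_Ici_comp_neg (φ : ℝ → ENNReal) :
    ∫⁻ s in Ici (0 : ℝ), φ (-s) = ∫⁻ s in Iic (0 : ℝ), φ s := by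
  have h := (Measure.measurePreserving_neg (volume : Measure ℝ)).setLIntegral_comp_preimage_emb
    (MeasurableEquiv.neg ℝ).measurableEmbedding φ (Iic 0)
  simpa using! h

theorem isWildOn_neg_comp_neg_Ici_iff :
    IsWildOn (fun t s => -f t (-s)) (Ici 0) ↔ IsWildOn f (Iic 0) := by
  simp only [IsWildOn, neg_neg, ← setLIntegral_Ici_comp_neg, and_comm]

theorem IsTame.exists_norm_le (ht : IsTame f)
    (hf : Continuous fun p : UnitAddCircle × ℝ => f p.1 p.2) (M : ℝ) :
    ∃ R, ∀ p ∈ C1, (∃ t, |p.1 t| ≤ M) → ∫ t, |p.2 t + f t (p.1 t)| ≤ M → ‖p.1‖ ≤ R := by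
  have hf' : Continuous fun p : UnitAddCircle × ℝ => -f p.1 (-p.2) :=
    (hf.comp (continuous_fst.prodMk continuous_snd.neg)).neg
  obtain ⟨R₁, upper⟩ := C1.exists_forall_le_of_not_isWildOn_Ici hf ht.1 M
  obtain ⟨R₂, lower⟩ := C1.exists_forall_le_of_not_isWildOn_Ici hf'
    (isWildOn_neg_comp_neg_Ici_iff.not.2 ht.2) M
  refine ⟨max R₁ R₂, fun p hp ⟨t₀, h0⟩ he => ?_⟩
  have heq : ∫ t, |(-p).2 t + -f t (-(-p).1 t)| = ∫ t, |p.2 t + f t (p.1 t)| := by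
    simp [← neg_add, abs_neg, -neg_add_rev]
  rw [ContinuousMap.norm_le_of_nonempty]
  exact fun t => abs_le'.2
    ⟨(upper p hp ⟨t₀, (abs_le.1 h0).2⟩ he t).trans (le_max_left _ _),
      (lower (-p) (neg_mem hp) ⟨t₀, neg_le.1 (abs_le.1 h0).1⟩ (heq.trans_le he) t).trans
        (le_max_right _ _)⟩

end Barrier

/-! ### The adapted map in the variable `u' + ū` -/

theorem C0.continuous_avg : Continuous meanC0.avg :=
  AddMonoidHomClass.continuous_of_bound meanC0.avg 1 fun u => by
    simpa [meanC0] using norm_integral_le_of_norm_le_const (μ := volume)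
      (Filter.Eventually.of_forall u.norm_coe_le_norm)

/-- A Banach space of functions on the circle, containing the continuous functions, together with
the operator `prim` which maps `w` to the function `u` such that `u' = w - ∫ w` and `∫ u = ∫ w`. -/
structure PrimitiveOperator {B : Type*} [NormedAddCommGroup B] [NormedSpace ℝ B]
    (S : MeanSplitting B) where
  continuous_avg : Continuous S.avg
  incl : C0 →L[ℝ] B
  denseRange_incl : DenseRange incl
  incl_one : incl meanC0.one = S.one
  avg_incl : ∀ g, S.avg (incl g) = meanC0.avg g
  integral_abs_le : ∀ g, ∫ t, |g t| ≤ ‖incl g‖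
  prim : B →L[ℝ] C0
  isCompactOperator_prim : IsCompactOperator prim
  avg_prim : ∀ w, meanC0.avg (prim w) = S.avg w
  prim_incl_mem : ∀ g, (prim (incl g), meanC0.tilde g) ∈ C1

section LocalBounds

variable {f : UnitAddCircle → ℝ → ℝ}

theorem exists_forall_abs_le (hf : Continuous fun p : UnitAddCircle × ℝ => f p.1 p.2) (R : ℝ) :
    ∃ C, ∀ t s, |s| ≤ R → |f t s| ≤ C := by
  obtain ⟨C, hC⟩ := (isCompact_univ.prod
    (isCompact_Icc (a := -R) (b := R))).exists_bound_of_continuousOn hf.continuousOn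
  exact ⟨C, fun t s hs => hC (t, s) ⟨mem_univ _, abs_le.1 hs⟩⟩

theorem exists_forall_norm_nemytskii_le (hf : IsSmoothNonlinearity f) (R : ℝ) :
    ∃ C, ∀ u, ‖u‖ ≤ R → ‖nemytskii f hf u‖ ≤ C := by
  obtain ⟨C, hC⟩ := exists_forall_abs_le hf.continuous R
  exact ⟨C, fun u hu => (ContinuousMap.norm_le_of_nonempty _).2 fun t =>
    hC t _ ((u.norm_coe_le_norm t).trans hu)⟩

theorem exists_forall_abs_nemytskii_sub_le (hf : IsSmoothNonlinearity f) (R : ℝ) :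
    ∃ L, ∀ u v : C0, ‖u‖ ≤ R → ‖v‖ ≤ R →
      ∀ t, |(nemytskii f hf u - nemytskii f hf v) t| ≤ L * |(u - v) t| := by
  obtain ⟨L, hL⟩ := exists_forall_abs_le hf.stateDeriv.continuous R
  exact ⟨L, fun u v hu hv t => (convex_Icc (-R) R).norm_image_sub_le_of_norm_hasDerivWithin_le
    (fun s _ => (hf.hasDerivAt t s).hasDerivWithinAt) (fun s hs => hL t s (abs_le.2 hs))
    (abs_le.1 ((v.norm_coe_le_norm t).trans hv)) (abs_le.1 ((u.norm_coe_le_norm t).trans hu))⟩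

end LocalBounds

/-- At a zero of `q` where `q' ≤ 0` (resp. `q' ≥ 0`) the average of `g` is at least (resp. at most)
the value of `g`. -/
theorem C1.abs_avg_le {q g : C0} {C : ℝ} (hq : (q, meanC0.tilde g) ∈ C1) (h0 : meanC0.avg q = 0)
    (hg : ∀ t, q t = 0 → |g t| ≤ C) : |meanC0.avg g| ≤ C := by
  have htilde (t : UnitAddCircle) : meanC0.tilde g t = g t - meanC0.avg g := by
    simp [MeanSplitting.tilde, meanC0]
  obtain ⟨t₀, ht₀⟩ := C0.exists_eq_avg q
  rw [h0] at ht₀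
  obtain ⟨s, hs, hs'⟩ := C1.exists_eq_and_deriv_nonpos hq t₀
  obtain ⟨r, hr, hr'⟩ := C1.exists_eq_and_deriv_nonneg hq t₀
  rw [htilde] at hs' hr'
  have hgs := abs_le.1 (hg s (hs.trans ht₀))
  have hgr := abs_le.1 (hg r (hr.trans ht₀))
  exact abs_le.2 ⟨by linarith, by linarith⟩

namespace PrimitiveOperator

variable {B : Type*} [NormedAddCommGroup B] [NormedSpace ℝ B] {S : MeanSplitting B}
  (P : PrimitiveOperator S)

/-- The map which sends a continuous function to its average-zero part, in `B`. -/
def inclTilde : C0 →L[ℝ] B := P.incl ∘L meanC0.tildeL C0.continuous_avg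

theorem inclTilde_apply (g : C0) : P.inclTilde g = P.incl (meanC0.tilde g) := rfl

theorem inclTilde_eq_tilde (g : C0) : P.inclTilde g = S.tilde (P.incl g) := by
  rw [inclTilde_apply, MeanSplitting.tilde, MeanSplitting.tilde, map_sub, map_smul, P.incl_one,
    P.avg_incl]

theorem avg_inclTilde (g : C0) : S.avg (P.inclTilde g) = 0 := by
  rw [inclTilde_eq_tilde, S.avg_tilde]

theorem prim_inclTilde_mem (g : C0) : (P.prim (P.inclTilde g), meanC0.tilde g) ∈ C1 := by
  have h := P.prim_incl_mem (meanC0.tilde g)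
  rwa [MeanSplitting.tilde_of_mem_zeroMean (meanC0.tilde_mem_zeroMean g)] at h

theorem avg_prim_inclTilde (g : C0) : meanC0.avg (P.prim (P.inclTilde g)) = 0 := by
  rw [P.avg_prim, avg_inclTilde]

theorem eq_zero_of_add_inclTilde_eq_zero {w : B} {g : C0} {L : ℝ} (hw : w + P.inclTilde g = 0)
    (hg : ∀ t, |g t| ≤ L * |P.prim w t|) : w = 0 := by
  have hprim : P.prim w = -P.prim (P.inclTilde g) := by
    rw [eq_neg_of_add_eq_zero_left hw, map_neg]
  have hk : (P.prim w, -g - (-meanC0.avg g) • meanC0.one) ∈ C1 := by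
    convert! neg_mem (P.prim_inclTilde_mem g) using 1
    rw [Prod.neg_mk, ← hprim, MeanSplitting.tilde, neg_sub, neg_smul]
    abel_nf
  have hzero : P.prim w = 0 := C1.eq_zero_of_abs_le hk (by simpa using hg) (by
    rw [hprim, map_neg, avg_prim_inclTilde, neg_zero])
  have hg0 : g = 0 := by
    ext t
    simpa [hzero] using hg t
  rwa [hg0, map_zero, add_zero] at hw

variable {f : UnitAddCircle → ℝ → ℝ} (hf : IsSmoothNonlinearity f)

/-- The map `u ↦ ṽ + ū` for `F u = u' + f(t, u)`, expressed in terms of `w = u' + ū`. -/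
def adapted (w : B) : B := w + P.inclTilde (nemytskii f hf (P.prim w))

theorem contDiff_adapted : ContDiff ℝ ∞ (P.adapted hf) :=
  contDiff_id.add (P.inclTilde.contDiff.comp ((contDiff_nemytskii hf).comp P.prim.contDiff))

theorem adapted_injective : Function.Injective (P.adapted hf) := by
  intro w₁ w₂ h
  obtain ⟨L, hL⟩ := exists_forall_abs_nemytskii_sub_le hf (max ‖P.prim w₁‖ ‖P.prim w₂‖)
  refine sub_eq_zero.1 (P.eq_zero_of_add_inclTilde_eq_zero (L := L)
    (g := nemytskii f hf (P.prim w₁) - nemytskii f hf (P.prim w₂)) ?_ ?_)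
  · rw [map_sub, sub_add_sub_comm]
    exact sub_eq_zero.2 h
  · rw [map_sub]
    exact hL _ _ (le_max_left _ _) (le_max_right _ _)

section LocalInversion

/-- The compact part `h ↦ (a k)~`, with `k = P.prim h`, of the linearization of the adapted map. -/
def compactPart (a : C0) : B →L[ℝ] B :=
  P.inclTilde ∘L (ContinuousLinearMap.mul ℝ C0 a : C0 →L[ℝ] C0) ∘L P.prim

theorem isCompactOperator_compactPart (a : C0) : IsCompactOperator (P.compactPart a) :=
  (P.isCompactOperator_prim.clm_comp (ContinuousLinearMap.mul ℝ C0 a : C0 →L[ℝ] C0)).clm_comp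
    P.inclTilde

theorem hasFDerivAt_adapted (w : B) : HasFDerivAt (P.adapted hf)
    (1 + P.compactPart (nemytskii (stateDeriv f) hf.stateDeriv (P.prim w))) w :=
  (hasFDerivAt_id w).add (P.inclTilde.hasFDerivAt.comp w
    ((hasFDerivAt_nemytskii hf (P.prim w)).comp w P.prim.hasFDerivAt))

theorem eq_zero_of_add_compactPart_eq_zero {a : C0} {w : B} (hw : w + P.compactPart a w = 0) :
    w = 0 :=
  P.eq_zero_of_add_inclTilde_eq_zero (L := ‖a‖) hw fun t => by
    change |a t * P.prim w t| ≤ _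
    rw [abs_mul]
    gcongr
    exact a.norm_coe_le_norm t

variable [CompleteSpace B]

theorem isUnit_one_add_compactPart (a : C0) : IsUnit (1 + P.compactPart a) := by
  -- Fredholm alternative: `-1` is either an eigenvalue or in the resolvent set.
  rcases (P.isCompactOperator_compactPart a).hasEigenvalue_or_mem_resolventSet
    (neg_ne_zero.2 (one_ne_zero (α := ℝ))) with h | h
  · obtain ⟨w, hw⟩ := h.exists_hasEigenvector
    have heigen : P.compactPart a w = -w := by simpa using hw.apply_eq_smul
    exact absurd (P.eq_zero_of_add_compactPart_eq_zero (by rw [heigen, add_neg_cancel])) hw.2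
  · rw [← IsUnit.neg_iff]
    simpa [spectrum.mem_resolventSet_iff, sub_eq_add_neg, add_comm] using h

theorem exists_hasFDerivAt_adapted_equiv (w : B) :
    ∃ A : B ≃L[ℝ] B, HasFDerivAt (P.adapted hf) (A : B →L[ℝ] B) w := by
  obtain ⟨U, hU⟩ := P.isUnit_one_add_compactPart
    (nemytskii (stateDeriv f) hf.stateDeriv (P.prim w))
  have hderiv := P.hasFDerivAt_adapted hf w
  rw [← hU] at hderiv
  exact ⟨ContinuousLinearEquiv.ofUnit U, hderiv⟩

theorem isOpenMap_adapted : IsOpenMap (P.adapted hf) := isOpenMap_iff_nhds_le.2 fun w => by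
  obtain ⟨A, hA⟩ := P.exists_hasFDerivAt_adapted_equiv hf w
  have hstrict := (P.contDiff_adapted hf).contDiffAt.hasStrictFDerivAt' hA (by simp)
  exact hstrict.map_nhds_eq_of_equiv.ge

end LocalInversion

section APrioriBound

theorem adapted_incl (g : C0) : P.adapted hf (P.incl g) =
    P.incl (g + meanC0.tilde (nemytskii f hf (P.prim (P.incl g)))) := by
  rw [adapted, inclTilde_apply, map_add]

theorem exists_forall_abs_avg_nemytskii_le (C : ℝ) : ∃ Λ, ∀ w, ‖P.adapted hf w‖ ≤ C →
    |meanC0.avg (nemytskii f hf (P.prim w))| ≤ Λ := by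
  obtain ⟨Λ, hΛ⟩ := exists_forall_abs_le hf.continuous (‖P.prim‖ * C)
  refine ⟨Λ, fun w hw => C1.abs_avg_le (P.prim_inclTilde_mem _) (P.avg_prim_inclTilde _)
    fun t ht => hΛ t _ ?_⟩
  have heq : P.prim w t = P.prim (P.adapted hf w) t := by
    rw [adapted, map_add, ContinuousMap.add_apply, ht, add_zero]
  rw [heq]
  exact ((P.prim _).norm_coe_le_norm t).trans (P.prim.le_opNorm_of_le hw)

theorem integral_abs_tilde_add_nemytskii_le (g : C0) :
    ∫ t, |meanC0.tilde g t + f t (P.prim (P.incl g) t)| ≤ 2 * ‖P.adapted hf (P.incl g)‖ +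
      |meanC0.avg (nemytskii f hf (P.prim (P.incl g)))| := by
  set N := nemytskii f hf (P.prim (P.incl g))
  set e := g + meanC0.tilde N with he
  have havg : |meanC0.avg g| ≤ ∫ t, |e t| := by
    have heq : meanC0.avg e = meanC0.avg g := by rw [he, map_add, meanC0.avg_tilde, add_zero]
    rw [← heq]
    exact abs_integral_le_integral_abs
  have hle (t : UnitAddCircle) :
      |meanC0.tilde g t + N t| ≤ |e t| + (|meanC0.avg N| + |meanC0.avg g|) := by
    have heq : meanC0.tilde g t + N t = e t + (meanC0.avg N - meanC0.avg g) := by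
      simp only [he, MeanSplitting.tilde, ContinuousMap.add_apply, ContinuousMap.sub_apply,
        ContinuousMap.smul_apply, meanC0, ContinuousMap.one_apply, smul_eq_mul, mul_one]
      ring
    rw [heq]
    exact (abs_add_le _ _).trans (by gcongr; exact abs_sub _ _)
  calc ∫ t, |meanC0.tilde g t + N t|
      ≤ ∫ t, (|e t| + (|meanC0.avg N| + |meanC0.avg g|)) :=
        integral_mono (C0.integrable (meanC0.tilde g + N)).abs
          ((C0.integrable e).abs.add (integrable_const _)) hle
    _ = (∫ t, |e t|) + (|meanC0.avg N| + |meanC0.avg g|) := by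
        rw [integral_add (C0.integrable e).abs (integrable_const _)]
        simp
    _ ≤ 2 * ‖P.adapted hf (P.incl g)‖ + |meanC0.avg N| := by
        have hnorm := P.integral_abs_le e
        rw [adapted_incl]
        linarith

theorem exists_norm_prim_incl_le (ht : IsTame f) (C : ℝ) :
    ∃ R, ∀ g, ‖P.adapted hf (P.incl g)‖ ≤ C → ‖P.prim (P.incl g)‖ ≤ R := by
  obtain ⟨Λ, hΛ⟩ := P.exists_forall_abs_avg_nemytskii_le hf C
  obtain ⟨R, hR⟩ := ht.exists_norm_le hf.continuous (max (‖P.prim‖ * C) (2 * C + Λ))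
  refine ⟨R, fun g hg => ?_⟩
  have hbase : ∃ t, |P.prim (P.incl g) t| ≤ ‖P.prim‖ * C := by
    -- `P.prim w` and `P.prim (P.adapted hf w)` have the same average, hence agree somewhere.
    obtain ⟨t, ht⟩ := C0.exists_eq_avg (P.prim (P.inclTilde (nemytskii f hf (P.prim (P.incl g)))))
    have heq : P.prim (P.incl g) t = P.prim (P.adapted hf (P.incl g)) t := by
      rw [adapted, map_add, ContinuousMap.add_apply, ht, avg_prim_inclTilde, add_zero]
    refine ⟨t, ?_⟩
    rw [heq]
    exact ((P.prim _).norm_coe_le_norm t).trans (P.prim.le_opNorm_of_le hg)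
  have hint : ∫ t, |meanC0.tilde g t + f t (P.prim (P.incl g) t)| ≤ 2 * C + Λ :=
    (P.integral_abs_tilde_add_nemytskii_le hf g).trans (by linarith [hΛ _ hg])
  exact hR (P.prim (P.incl g), meanC0.tilde g) (P.prim_incl_mem g)
    (hbase.imp fun _ h => h.trans (le_max_left _ _)) (hint.trans (le_max_right _ _))

theorem exists_norm_prim_le (ht : IsTame f) (C : ℝ) :
    ∃ R, ∀ w, ‖P.adapted hf w‖ ≤ C → ‖P.prim w‖ ≤ R := by
  obtain ⟨R, hR⟩ := P.exists_norm_prim_incl_le hf ht (C + 1)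
  refine ⟨R, fun w hw => ?_⟩
  have hopen : IsOpen {w | ‖P.adapted hf w‖ < C + 1} :=
    isOpen_lt (P.contDiff_adapted hf).continuous.norm continuous_const
  have hclosed : IsClosed {w | ‖P.prim w‖ ≤ R} :=
    isClosed_le P.prim.continuous.norm continuous_const
  refine closure_minimal ?_ hclosed
    (P.denseRange_incl.open_subset_closure_inter hopen (hw.trans_lt (lt_add_one C)))
  rintro _ ⟨hlt, g, rfl⟩
  exact hR g (le_of_lt hlt)

theorem exists_norm_le_of_norm_adapted_le (ht : IsTame f) (C : ℝ) :
    ∃ R, ∀ w, ‖P.adapted hf w‖ ≤ C → ‖w‖ ≤ R := by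
  obtain ⟨R, hR⟩ := P.exists_norm_prim_le hf ht C
  obtain ⟨D, hD⟩ := exists_forall_norm_nemytskii_le hf R
  refine ⟨C + ‖P.inclTilde‖ * D, fun w hw => ?_⟩
  calc ‖w‖ = ‖P.adapted hf w - P.inclTilde (nemytskii f hf (P.prim w))‖ := by
        rw [adapted, add_sub_cancel_right]
    _ ≤ C + ‖P.inclTilde‖ * D :=
        norm_sub_le_of_le hw (P.inclTilde.le_opNorm_of_le (hD _ (hR w hw)))

theorem isClosed_range_adapted (ht : IsTame f) : IsClosed (range (P.adapted hf)) := by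
  refine isClosed_of_closure_subset fun z hz => ?_
  obtain ⟨s, hs, hsz⟩ := mem_closure_iff_seq_limit.1 hz
  choose w hw using hs
  obtain ⟨C, hC⟩ := hsz.norm.bddAbove_range
  obtain ⟨R, hR⟩ := P.exists_norm_le_of_norm_adapted_le hf ht C
  have hbdd (n) : w n ∈ Metric.closedBall (0 : B) R :=
    mem_closedBall_zero_iff.2 (hR _ (by rw [hw]; exact hC ⟨n, rfl⟩))
  obtain ⟨K, hK, hKsub⟩ := P.isCompactOperator_prim.image_closedBall_subset_compact R
  obtain ⟨u, -, φ, hφ, hu⟩ := hK.tendsto_subseq fun n => hKsub ⟨w n, hbdd n, rfl⟩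
  have hs' : Filter.Tendsto (P.adapted hf ∘ w ∘ φ) Filter.atTop (nhds z) := by
    refine (hsz.comp hφ.tendsto_atTop).congr fun n => ?_
    simp only [Function.comp_apply, hw]
  have hlim : Filter.Tendsto (w ∘ φ) Filter.atTop
      (nhds (z - P.inclTilde (nemytskii f hf u))) := by
    refine (hs'.sub
      (((P.inclTilde.continuous.comp (continuous_nemytskii hf)).tendsto u).comp hu)).congr
      fun n => ?_
    exact add_sub_cancel_right (w (φ n)) _
  exact ⟨_, tendsto_nhds_unique (((P.contDiff_adapted hf).continuous.tendsto _).comp hlim) hs'⟩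

end APrioriBound

variable [CompleteSpace B]

theorem bijective_adapted (ht : IsTame f) : Function.Bijective (P.adapted hf) :=
  ⟨P.adapted_injective hf, range_eq_univ.1 <| IsClopen.eq_univ
    ⟨P.isClosed_range_adapted hf ht, (P.isOpenMap_adapted hf).isOpen_range⟩ (range_nonempty _)⟩

theorem exists_diffeomorph_adapted (ht : IsTame f) :
    ∃ Θ : Diffeomorph 𝓘(ℝ, B) 𝓘(ℝ, B) B B ∞, ∀ w, Θ w = P.adapted hf w := by
  have hsmooth := P.contDiff_adapted hf
  let e := (Equiv.ofBijective _ (P.bijective_adapted hf ht)).toHomeomorphOfContinuousOpen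
    hsmooth.continuous (P.isOpenMap_adapted hf)
  choose A hA using P.exists_hasFDerivAt_adapted_equiv hf
  exact ⟨⟨e.toEquiv, hsmooth.contMDiff, (e.contDiff_symm hA hsmooth).contMDiff⟩, fun _ => rfl⟩

end PrimitiveOperator

/-- A Banach space of functions on the circle with derivatives in `B`, where `deriv u = u'`, `rep u`
is the continuous representative of `u`, and `antideriv w` is `P.prim w` as an element of `B₁`. -/
structure DerivativeOperator {B₁ B : Type*} [NormedAddCommGroup B₁] [NormedSpace ℝ B₁]
    [NormedAddCommGroup B] [NormedSpace ℝ B] (S₁ : MeanSplitting B₁) {S : MeanSplitting B}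
    (P : PrimitiveOperator S) where
  continuous_avg : Continuous S₁.avg
  deriv : B₁ →L[ℝ] B
  avg_deriv : ∀ u, S.avg (deriv u) = 0
  eq_zero_of_deriv_eq_zero : ∀ u, deriv u = 0 → S₁.avg u = 0 → u = 0
  rep : B₁ → C0
  antideriv : B →L[ℝ] B₁
  deriv_antideriv : ∀ w, deriv (antideriv w) = S.tilde w
  avg_antideriv : ∀ w, S₁.avg (antideriv w) = S.avg w
  rep_antideriv : ∀ w, rep (antideriv w) = P.prim w

namespace DerivativeOperator

variable {B₁ B : Type*} [NormedAddCommGroup B₁] [NormedSpace ℝ B₁] [NormedAddCommGroup B]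
  [NormedSpace ℝ B] {S₁ : MeanSplitting B₁} {S : MeanSplitting B} {P : PrimitiveOperator S}
  (D : DerivativeOperator S₁ P)

/-- The map `u ↦ u' + ū`. -/
def derivAddAvg : B₁ →L[ℝ] B := D.deriv + (S₁.avgL D.continuous_avg).smulRight S.one

theorem derivAddAvg_apply (u : B₁) : D.derivAddAvg u = D.deriv u + S₁.avg u • S.one := rfl

theorem avg_derivAddAvg (u : B₁) : S.avg (D.derivAddAvg u) = S₁.avg u :=
  MeanSplitting.avg_add_smul_one_of_mem_zeroMean (D.avg_deriv u) _

theorem tilde_derivAddAvg (u : B₁) : S.tilde (D.derivAddAvg u) = D.deriv u :=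
  MeanSplitting.tilde_add_smul_one_of_mem_zeroMean (D.avg_deriv u) _

theorem antideriv_derivAddAvg (u : B₁) : D.antideriv (D.derivAddAvg u) = u :=
  sub_eq_zero.1 (D.eq_zero_of_deriv_eq_zero _
    (by rw [map_sub, deriv_antideriv, tilde_derivAddAvg, sub_self])
    (by rw [map_sub, avg_antideriv, avg_derivAddAvg, sub_self]))

theorem derivAddAvg_antideriv (w : B) : D.derivAddAvg (D.antideriv w) = w := by
  rw [derivAddAvg_apply, deriv_antideriv, avg_antideriv, S.tilde_add_avg_smul_one]

/-- The isomorphism `u ↦ u' + ū`. -/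
def derivAddAvgEquiv : B₁ ≃L[ℝ] B :=
  ContinuousLinearEquiv.equivOfInverse D.derivAddAvg D.antideriv D.antideriv_derivAddAvg
    D.derivAddAvg_antideriv

theorem rep_eq (u : B₁) : D.rep u = P.prim (D.derivAddAvg u) := by
  rw [← D.rep_antideriv, D.antideriv_derivAddAvg]

variable {f : UnitAddCircle → ℝ → ℝ} (hf : IsSmoothNonlinearity f)

/-- The operator `F u = u' + f(t, u)`. -/
def operator (u : B₁) : B := D.deriv u + P.incl (nemytskii f hf (D.rep u))

theorem contDiff_operator : ContDiff ℝ ∞ (D.operator hf) := by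
  refine D.deriv.contDiff.add (P.incl.contDiff.comp ((contDiff_nemytskii hf).comp ?_))
  rw [funext D.rep_eq]
  exact P.prim.contDiff.comp D.derivAddAvg.contDiff

theorem adaptedMap_operator (u : B₁) :
    adaptedMap S₁ S (D.operator hf) u = P.adapted hf (D.derivAddAvg u) := by
  have htilde : S.tilde (D.operator hf u) =
      D.deriv u + P.inclTilde (nemytskii f hf (D.rep u)) := by
    rw [operator, ← S.tildeL_apply P.continuous_avg, map_add, S.tildeL_apply, S.tildeL_apply,
      MeanSplitting.tilde_of_mem_zeroMean (D.avg_deriv u), P.inclTilde_eq_tilde]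
  rw [adaptedMap, htilde, add_right_comm, PrimitiveOperator.adapted, D.rep_eq, derivAddAvg_apply]

theorem hasGlobalAdaptedCoordinates [CompleteSpace B] (ht : IsTame f) :
    HasGlobalAdaptedCoordinates S₁ S (D.operator hf) := by
  obtain ⟨Θ, hΘ⟩ := P.exists_diffeomorph_adapted hf ht
  exact hasGlobalAdaptedCoordinates_of_diffeomorph D.continuous_avg P.continuous_avg
    (D.contDiff_operator hf) (D.derivAddAvgEquiv.toDiffeomorph.trans Θ)
    fun u => (hΘ (D.derivAddAvg u)).trans (D.adaptedMap_operator hf u).symm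

end DerivativeOperator

/-! ### Primitives of square integrable functions -/

section Circle

theorem ae_coe_of_ae {p : UnitAddCircle → Prop} (h : ∀ᵐ t, p t) :
    ∀ᵐ x : ℝ, p (x : UnitAddCircle) := by
  rw [← Measure.restrict_univ (μ := (volume : Measure ℝ)), ← iUnion_Ioc_intCast ℝ,
    ae_restrict_iUnion_iff]
  exact fun n => (UnitAddCircle.measurePreserving_mk n).quasiMeasurePreserving.ae h

theorem intervalIntegrable_coe {v : UnitAddCircle → ℝ} (hv : Integrable v) (a b : ℝ) :
    IntervalIntegrable (fun x : ℝ => v (x : UnitAddCircle)) volume a b := by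
  refine (periodic_lift v).intervalIntegrable one_ne_zero (t := 0) ?_ a b
  rw [intervalIntegrable_iff_integrableOn_Ioc_of_le (by norm_num)]
  exact ((UnitAddCircle.measurePreserving_mk 0).integrable_comp hv.aestronglyMeasurable).2 hv

theorem intervalIntegral_coe_congr_ae {v w : UnitAddCircle → ℝ} (h : v =ᵐ[volume] w) (a b : ℝ) :
    ∫ x in a..b, v (x : UnitAddCircle) = ∫ x in a..b, w (x : UnitAddCircle) :=
  intervalIntegral.integral_congr_ae ((ae_coe_of_ae h).mono fun _ hx _ => hx)

end Circle

section PrimitiveL2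

theorem L2.integrable (w : L2) : Integrable w := (Lp.memLp w).integrable one_le_two

theorem L2.integral_abs_le (w : L2) : ∫ t, |w t| ≤ ‖w‖ := by
  have h := integral_norm_eq_lintegral_enorm (Lp.aestronglyMeasurable w)
  rw [← eLpNorm_one_eq_lintegral_enorm] at h
  simp only [Real.norm_eq_abs] at h
  rw [h, Lp.norm_def]
  exact ENNReal.toReal_mono (Lp.eLpNorm_ne_top w)
    (eLpNorm_le_eLpNorm_of_exponent_le one_le_two (Lp.aestronglyMeasurable w))

theorem L2.continuous_avg : Continuous meanL2.avg :=
  AddMonoidHomClass.continuous_of_bound meanL2.avg 1 fun w => by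
    rw [one_mul]
    exact abs_integral_le_integral_abs.trans w.integral_abs_le

theorem L2.abs_intervalIntegral_le (v : L2) {x y : ℝ} (hy : |y - x| ≤ 1) :
    |∫ r in x..y, v (r : UnitAddCircle)| ≤ √|y - x| * ‖v‖ := by
  wlog hxy : x ≤ y generalizing x y
  · rw [intervalIntegral.integral_symm, abs_neg, abs_sub_comm]
    exact this (by rwa [abs_sub_comm]) (le_of_not_ge hxy)
  rw [abs_of_nonneg (sub_nonneg.2 hxy)] at hy ⊢
  set g : ℝ → ℝ := fun r => v (r : UnitAddCircle)
  have hpres := UnitAddCircle.measurePreserving_mk x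
  have hsub : volume.restrict (Ioc x y) ≤ volume.restrict (Ioc x (x + 1)) :=
    Measure.restrict_mono (Ioc_subset_Ioc_right (sub_le_iff_le_add'.1 hy)) le_rfl
  have hmeas : AEStronglyMeasurable g (volume.restrict (Ioc x y)) :=
    ((Lp.aestronglyMeasurable v).comp_measurePreserving hpres).mono_measure hsub
  have htwo : eLpNorm g 2 (volume.restrict (Ioc x y)) ≤ eLpNorm v 2 volume :=
    (eLpNorm_mono_measure g hsub).trans_eq
      (eLpNorm_comp_measurePreserving (Lp.aestronglyMeasurable v) hpres)
  have hone : eLpNorm g 1 (volume.restrict (Ioc x y)) ≤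
      eLpNorm v 2 volume * ENNReal.ofReal (√(y - x)) := by
    refine (eLpNorm_le_eLpNorm_mul_rpow_measure_univ one_le_two hmeas).trans ?_
    gcongr
    rw [Measure.restrict_apply_univ, Real.volume_Ioc, Real.sqrt_eq_rpow,
      ENNReal.ofReal_rpow_of_nonneg (sub_nonneg.2 hxy) (by norm_num)]
    norm_num
  calc |∫ r in x..y, g r| ≤ ∫ r in Ioc x y, ‖g r‖ := by
        rw [intervalIntegral.integral_of_le hxy]
        exact norm_integral_le_integral_norm g
    _ = (eLpNorm g 1 (volume.restrict (Ioc x y))).toReal := by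
        rw [integral_norm_eq_lintegral_enorm hmeas, eLpNorm_one_eq_lintegral_enorm]
    _ ≤ (eLpNorm v 2 volume * ENNReal.ofReal (√(y - x))).toReal :=
        ENNReal.toReal_mono (ENNReal.mul_ne_top (Lp.eLpNorm_ne_top v) ENNReal.ofReal_ne_top) hone
    _ = √(y - x) * ‖v‖ := by
        rw [ENNReal.toReal_mul, ENNReal.toReal_ofReal (Real.sqrt_nonneg _), mul_comm, Lp.norm_def]

theorem continuous_intervalIntegral_coe (v : L2) :
    Continuous fun x : ℝ => ∫ r in (0 : ℝ)..x, v (r : UnitAddCircle) :=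
  intervalIntegral.continuous_primitive (intervalIntegrable_coe v.integrable) 0

theorem periodic_intervalIntegral_coe (v : meanL2.zeroMean) :
    Function.Periodic (fun x : ℝ => ∫ r in (0 : ℝ)..x, (v : L2) (r : UnitAddCircle)) 1 :=
  fun x => by
  have hint := intervalIntegrable_coe (v : L2).integrable
  have hperiod : ∫ r in x..x + 1, (v : L2) (r : UnitAddCircle) = 0 :=
    (UnitAddCircle.intervalIntegral_preimage x (v : L2)).trans v.2
  simp only [← intervalIntegral.integral_add_adjacent_intervals (hint 0 x) (hint x (x + 1)),
    hperiod, add_zero]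

/-- The primitive, vanishing at `0`, of a square integrable function of average zero. -/
def zeroMeanPrimitive : meanL2.zeroMean →ₗ[ℝ] C0 where
  toFun v :=
    { toFun := (periodic_intervalIntegral_coe v).lift
      continuous_toFun := QuotientAddGroup.isOpenQuotientMap_mk.isQuotientMap.continuous_iff.2
        (continuous_intervalIntegral_coe v) }
  map_add' v w := by
    ext t
    obtain ⟨x, rfl⟩ := QuotientAddGroup.mk_surjective t
    exact (intervalIntegral_coe_congr_ae (Lp.coeFn_add (v : L2) w) 0 x).trans
      (intervalIntegral.integral_add (intervalIntegrable_coe (v : L2).integrable 0 x)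
        (intervalIntegrable_coe (w : L2).integrable 0 x))
  map_smul' c v := by
    ext t
    obtain ⟨x, rfl⟩ := QuotientAddGroup.mk_surjective t
    exact (intervalIntegral_coe_congr_ae (Lp.coeFn_smul c (v : L2)) 0 x).trans
      (intervalIntegral.integral_const_mul c _)

theorem zeroMeanPrimitive_coe (v : meanL2.zeroMean) (x : ℝ) :
    zeroMeanPrimitive v (x : UnitAddCircle) = ∫ r in (0 : ℝ)..x, (v : L2) (r : UnitAddCircle) :=
  rfl

theorem exists_coe_eq_abs_eq_norm (t : UnitAddCircle) : ∃ x : ℝ, x = t ∧ |x| = ‖t‖ := by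
  obtain ⟨x, rfl⟩ := QuotientAddGroup.mk_surjective t
  refine ⟨x - round x, ?_, (UnitAddCircle.norm_eq).symm⟩
  simp

theorem dist_zeroMeanPrimitive_le (v : meanL2.zeroMean) (s t : UnitAddCircle) :
    dist (zeroMeanPrimitive v s) (zeroMeanPrimitive v t) ≤ √(dist s t) * ‖v‖ := by
  obtain ⟨y, rfl⟩ := QuotientAddGroup.mk_surjective t
  obtain ⟨r, hr, hnorm⟩ := exists_coe_eq_abs_eq_norm (s - (y : UnitAddCircle))
  obtain rfl : ((y + r : ℝ) : UnitAddCircle) = s := by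
    rw [AddCircle.coe_add, hr, add_sub_cancel]
  have hint := intervalIntegrable_coe (v : L2).integrable
  have hle : |y + r - y| ≤ 1 := by
    have := AddCircle.norm_le_half_period 1 one_ne_zero (x := ((y + r : ℝ) - y : UnitAddCircle))
    rw [add_sub_cancel_left, hnorm]
    exact this.trans (by norm_num)
  calc dist (zeroMeanPrimitive v (y + r : ℝ)) (zeroMeanPrimitive v y)
      = |∫ q in y..y + r, (v : L2) (q : UnitAddCircle)| := by
        rw [Real.dist_eq, zeroMeanPrimitive_coe, zeroMeanPrimitive_coe,
          intervalIntegral.integral_interval_sub_left (hint 0 _) (hint 0 _)]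
    _ ≤ √|y + r - y| * ‖v‖ := (v : L2).abs_intervalIntegral_le hle
    _ = _ := by rw [add_sub_cancel_left, hnorm, dist_eq_norm]

theorem norm_zeroMeanPrimitive_le (v : meanL2.zeroMean) : ‖zeroMeanPrimitive v‖ ≤ ‖v‖ := by
  refine (ContinuousMap.norm_le _ (norm_nonneg _)).2 fun t => ?_
  have hzero : zeroMeanPrimitive v 0 = 0 := intervalIntegral.integral_same
  have hdist : dist t 0 ≤ 1 := by
    rw [dist_zero_right]
    exact (AddCircle.norm_le_half_period 1 one_ne_zero).trans (by norm_num)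
  calc ‖zeroMeanPrimitive v t‖ = dist (zeroMeanPrimitive v t) (zeroMeanPrimitive v 0) := by
        rw [hzero, dist_zero_right]
    _ ≤ √(dist t 0) * ‖v‖ := dist_zeroMeanPrimitive_le v t 0
    _ ≤ ‖v‖ := mul_le_of_le_one_left (norm_nonneg _) (Real.sqrt_le_one.2 hdist)

/-- `zeroMeanPrimitive` as a continuous linear map. -/
def zeroMeanPrimitiveL : meanL2.zeroMean →L[ℝ] C0 :=
  zeroMeanPrimitive.mkContinuous 1 fun v => by
    rw [one_mul]
    exact norm_zeroMeanPrimitive_le v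

theorem isCompactOperator_zeroMeanPrimitiveL : IsCompactOperator zeroMeanPrimitiveL := by
  refine (isCompactOperator_iff_image_closedBall_subset_compact
    (zeroMeanPrimitiveL : meanL2.zeroMean →ₗ[ℝ] C0) one_pos).2 ?_
  let e := ContinuousMap.isometryEquivBoundedOfCompact UnitAddCircle ℝ
  let A := e '' (zeroMeanPrimitiveL '' Metric.closedBall 0 1)
  have hA : IsCompact (closure A) := by
    refine BoundedContinuousFunction.arzela_ascoli (Icc (-1) 1) isCompact_Icc A ?_ ?_
    · rintro _ t ⟨_, ⟨v, hv, rfl⟩, rfl⟩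
      rw [mem_closedBall_zero_iff] at hv
      exact abs_le.1 (((zeroMeanPrimitive v).norm_coe_le_norm t).trans
        ((norm_zeroMeanPrimitive_le v).trans hv))
    · refine Metric.equicontinuous_of_continuity_modulus Real.sqrt ?_ _ ?_
      · simpa using Real.continuous_sqrt.tendsto 0
      · rintro s t ⟨_, _, ⟨v, hv, rfl⟩, rfl⟩
        rw [mem_closedBall_zero_iff] at hv
        exact (dist_zeroMeanPrimitive_le v s t).trans
          (mul_le_of_le_one_right (Real.sqrt_nonneg _) hv)
  refine ⟨e.symm '' closure A, hA.image e.symm.continuous, ?_⟩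
  rintro _ ⟨v, hv, rfl⟩
  exact ⟨e (zeroMeanPrimitiveL v), subset_closure ⟨_, ⟨v, hv, rfl⟩, rfl⟩, e.symm_apply_apply _⟩

/-- The operator which maps `w` to the function `u` such that `u' = w - ∫ w` and `∫ u = ∫ w`. -/
def primitiveL2 : L2 →L[ℝ] C0 :=
  meanC0.tildeL C0.continuous_avg ∘L zeroMeanPrimitiveL ∘L meanL2.projL L2.continuous_avg +
    (meanL2.avgL L2.continuous_avg).smulRight meanC0.one

theorem isCompactOperator_primitiveL2 : IsCompactOperator primitiveL2 := by
  have hconst := (isCompactOperator_of_locallyCompactSpace_rng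
    (ContinuousLinearMap.toSpanSingleton ℝ meanC0.one)).comp_clm (meanL2.avgL L2.continuous_avg)
  have hprim := (isCompactOperator_zeroMeanPrimitiveL.comp_clm
    (meanL2.projL L2.continuous_avg)).clm_comp (meanC0.tildeL C0.continuous_avg)
  exact hprim.add hconst

theorem avg_primitiveL2 (w : L2) : meanC0.avg (primitiveL2 w) = meanL2.avg w :=
  MeanSplitting.avg_add_smul_one_of_mem_zeroMean (meanC0.tilde_mem_zeroMean _) _

theorem exists_primitiveL2_coe_eq (w : L2) : ∃ c, ∀ x : ℝ,
    primitiveL2 w (x : UnitAddCircle) =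
      (∫ r in (0 : ℝ)..x, meanL2.tilde w (r : UnitAddCircle)) + c := by
  set I := zeroMeanPrimitiveL (meanL2.projL L2.continuous_avg w)
  refine ⟨meanL2.avg w - meanC0.avg I, fun x => ?_⟩
  change I x - meanC0.avg I * 1 + meanL2.avg w * 1 = I x + (meanL2.avg w - meanC0.avg I)
  ring

/-- The inclusion of the continuous functions in `L²`. -/
def inclL2 : C0 →L[ℝ] L2 := ContinuousMap.toLp 2 volume ℝ

theorem coeFn_inclL2 (g : C0) : inclL2 g =ᵐ[volume] g := ContinuousMap.coeFn_toLp _ _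

theorem avg_inclL2 (g : C0) : meanL2.avg (inclL2 g) = meanC0.avg g :=
  integral_congr_ae (coeFn_inclL2 g)

theorem tilde_inclL2 (g : C0) : meanL2.tilde (inclL2 g) = inclL2 (meanC0.tilde g) := by
  rw [MeanSplitting.tilde, MeanSplitting.tilde, map_sub, map_smul, avg_inclL2]
  rfl

theorem primitiveL2_inclL2_mem_C1 (g : C0) :
    (primitiveL2 (inclL2 g), meanC0.tilde g) ∈ C1 := fun x => by
  obtain ⟨c, hc⟩ := exists_primitiveL2_coe_eq (inclL2 g)
  have hcont : Continuous fun y : ℝ => meanC0.tilde g (y : UnitAddCircle) :=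
    (meanC0.tilde g).continuous.comp (AddCircle.continuous_mk' 1)
  have hprim : (fun y : ℝ => primitiveL2 (inclL2 g) (y : UnitAddCircle)) =
      fun y => (∫ r in (0 : ℝ)..y, meanC0.tilde g (r : UnitAddCircle)) + c := by
    ext y
    rw [hc, tilde_inclL2, intervalIntegral_coe_congr_ae (coeFn_inclL2 _)]
  change HasDerivAt (fun y : ℝ => primitiveL2 (inclL2 g) (y : UnitAddCircle)) _ x
  rw [hprim]
  exact (hcont.integral_hasStrictDerivAt 0 x).hasDerivAt.add_const c

theorem isACRep_primitiveL2 (w : L2) :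
    IsACRep (primitiveL2 w) (inclL2 (primitiveL2 w)) (meanL2.tilde w) := by
  obtain ⟨c, hc⟩ := exists_primitiveL2_coe_eq w
  have hint := intervalIntegrable_coe (meanL2.tilde w).integrable 0 1
  have hconst : AbsolutelyContinuousOnInterval (fun _ : ℝ => c) 0 1 :=
    contDiff_const.contDiffOn.absolutelyContinuousOnInterval
  rw [IsACRep, funext hc]
  refine ⟨coeFn_inclL2 _,
    (hint.absolutelyContinuousOnInterval_intervalIntegral left_mem_uIcc).add hconst, ?_⟩
  rw [ae_restrict_iff' measurableSet_Ioc]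
  filter_upwards [hint.ae_hasDerivAt_integral] with x hx hx01
  exact (hx (uIoc_subset_uIcc (Ioc_subset_uIoc hx01)) 0 left_mem_uIcc).add_const c

/-- The primitive operator on `L²`. -/
def primitiveOperatorL2 : PrimitiveOperator meanL2 where
  continuous_avg := L2.continuous_avg
  incl := inclL2
  denseRange_incl := ContinuousMap.toLp_denseRange ℝ volume ℝ (by simp)
  incl_one := rfl
  avg_incl := avg_inclL2
  integral_abs_le g := by
    refine le_of_eq_of_le (integral_congr_ae ?_) (inclL2 g).integral_abs_le
    filter_upwards [coeFn_inclL2 g] with t ht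
    rw [ht]
  prim := primitiveL2
  isCompactOperator_prim := isCompactOperator_primitiveL2
  avg_prim := avg_primitiveL2
  prim_incl_mem := primitiveL2_inclL2_mem_C1

/-- The primitive operator on `C⁰`. -/
def primitiveOperatorC0 : PrimitiveOperator meanC0 where
  continuous_avg := C0.continuous_avg
  incl := ContinuousLinearMap.id ℝ C0
  denseRange_incl := Function.surjective_id.denseRange
  incl_one := rfl
  avg_incl _ := rfl
  integral_abs_le g := by
    simpa using (integral_mono g.integrable.abs (integrable_const ‖g‖) g.norm_coe_le_norm)
  prim := primitiveL2 ∘L inclL2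
  isCompactOperator_prim := isCompactOperator_primitiveL2.comp_clm inclL2
  avg_prim w := (avg_primitiveL2 _).trans (avg_inclL2 w)
  prim_incl_mem := primitiveL2_inclL2_mem_C1

end PrimitiveL2

section DerivativeOperators

theorem C1.avg_deriv {p : C0 × C0} (hp : p ∈ C1) : meanC0.avg p.2 = 0 := by
  have hcont : Continuous fun x : ℝ => p.2 (x : UnitAddCircle) :=
    p.2.continuous.comp (AddCircle.continuous_mk' 1)
  calc meanC0.avg p.2 = ∫ x in (0 : ℝ)..0 + 1, p.2 (x : UnitAddCircle) :=
        (UnitAddCircle.intervalIntegral_preimage 0 p.2).symm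
    _ = p.1 ((0 + 1 : ℝ) : UnitAddCircle) - p.1 ((0 : ℝ) : UnitAddCircle) :=
        intervalIntegral.integral_eq_sub_of_hasDerivAt (fun x _ => hp x)
          (hcont.intervalIntegrable _ _)
    _ = 0 := sub_eq_zero.2 (periodic_lift p.1 0)

/-- The operator `u ↦ u'` from `C¹` to `C⁰`. -/
def derivativeOperatorC1 : DerivativeOperator (B₁ := C1) meanC1 primitiveOperatorC0 where
  continuous_avg := C0.continuous_avg.comp (continuous_fst.comp continuous_subtype_val)
  deriv := ContinuousLinearMap.snd ℝ C0 C0 ∘L C1.subtypeL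
  avg_deriv u := C1.avg_deriv u.2
  eq_zero_of_deriv_eq_zero u hderiv havg := by
    have hmem : (u.1.1, (0 : C0) - (0 : ℝ) • meanC0.one) ∈ C1 := by
      rw [zero_smul, sub_zero, ← hderiv]
      exact u.2
    have hzero := C1.eq_zero_of_abs_le (L := 0) hmem (fun t => by simp) havg
    exact Subtype.ext (Prod.ext hzero hderiv)
  rep u := u.1.1
  antideriv := (primitiveOperatorC0.prim.prod (meanC0.tildeL C0.continuous_avg)).codRestrict C1
    primitiveL2_inclL2_mem_C1
  deriv_antideriv _ := rfl
  avg_antideriv := primitiveOperatorC0.avg_prim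
  rep_antideriv _ := rfl

theorem IsACRep.eq_inclL2 {r : C0} {u g : L2} (h : IsACRep r u g) : u = inclL2 r :=
  Lp.ext (h.1.trans (coeFn_inclL2 r).symm)

theorem ae_uIcc_of_ae_restrict_Ioc {p : ℝ → Prop}
    (h : ∀ᵐ x ∂(volume.restrict (Ioc (0 : ℝ) 1)), p x) : ∀ᵐ x : ℝ, x ∈ uIcc (0 : ℝ) 1 → p x := by
  rw [restrict_Ioc_eq_restrict_Icc, ae_restrict_iff' measurableSet_Icc] at h
  rwa [uIcc_of_le zero_le_one]

theorem IsACRep.avg_deriv {r : C0} {u g : L2} (h : IsACRep r u g) : meanL2.avg g = 0 := by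
  have hderiv : ∀ᵐ x : ℝ, x ∈ uIoc (0 : ℝ) 1 →
      g (x : UnitAddCircle) = deriv (fun y : ℝ => r (y : UnitAddCircle)) x := by
    filter_upwards [ae_uIcc_of_ae_restrict_Ioc h.2.2] with x hx hx01
    exact (hx (uIoc_subset_uIcc hx01)).deriv.symm
  calc meanL2.avg g = ∫ x in (0 : ℝ)..0 + 1, g (x : UnitAddCircle) :=
        (UnitAddCircle.intervalIntegral_preimage 0 g).symm
    _ = ∫ x in (0 : ℝ)..1, deriv (fun y : ℝ => r (y : UnitAddCircle)) x := by
        rw [zero_add]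
        exact intervalIntegral.integral_congr_ae hderiv
    _ = r ((1 : ℝ) : UnitAddCircle) - r ((0 : ℝ) : UnitAddCircle) := h.2.1.integral_deriv_eq_sub
    _ = 0 := sub_eq_zero.2 (by simpa using periodic_lift r 0)

theorem IsACRep.eq_zero {r : C0} {u : L2} (h : IsACRep r u 0) (havg : meanL2.avg u = 0) :
    r = 0 := by
  have hderiv : ∀ᵐ x : ℝ, x ∈ uIcc (0 : ℝ) 1 →
      HasDerivAt (fun y : ℝ => r (y : UnitAddCircle)) 0 x := by
    filter_upwards [ae_uIcc_of_ae_restrict_Ioc h.2.2,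
      ae_coe_of_ae (Lp.coeFn_zero ℝ 2 (volume : Measure UnitAddCircle))] with x hx hzero hx01
    simpa [hzero] using hx hx01
  obtain ⟨C, hC⟩ := h.2.1.const_of_ae_hasDerivAt_zero hderiv
  have hr : r = C • meanC0.one := by
    ext t
    obtain ⟨y, rfl⟩ := QuotientAddGroup.mk_surjective t
    obtain ⟨x, hx, hxy⟩ := (periodic_lift r).exists_mem_Ico₀ one_pos y
    exact hxy.trans ((hC x (Icc_subset_uIcc (Ico_subset_Icc_self hx))).trans (mul_one C).symm)
  have hC0 : C = 0 := by
    rw [h.eq_inclL2, avg_inclL2, hr, map_smul, meanC0.avg_one, smul_eq_mul, mul_one] at havg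
    exact havg
  rw [hr, hC0, zero_smul]

theorem inclL2_injective : Function.Injective inclL2 := ContinuousMap.toLp_injective volume

/-- The operator `u ↦ u'` from `H¹` to `L²`. -/
def derivativeOperatorH1 : DerivativeOperator (B₁ := H1) meanH1 primitiveOperatorL2 where
  continuous_avg :=
    L2.continuous_avg.comp ((WithLp.fstL 2 ℝ L2 L2).continuous.comp continuous_subtype_val)
  deriv := WithLp.sndL 2 ℝ L2 L2 ∘L H1.subtypeL
  avg_deriv u := (H1rep_spec u).avg_deriv
  eq_zero_of_deriv_eq_zero u hderiv havg := by
    have hsnd : u.1.snd = 0 := hderiv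
    have hrep := H1rep_spec u
    rw [hsnd] at hrep
    have hfst : u.1.fst = 0 := by rw [hrep.eq_inclL2, hrep.eq_zero havg, map_zero]
    exact Subtype.ext ((WithLp.equiv 2 (L2 × L2)).injective (Prod.ext hfst hsnd))
  rep := H1rep
  antideriv := ((WithLp.prodContinuousLinearEquiv 2 ℝ L2 L2).symm.toContinuousLinearMap ∘L
    (inclL2 ∘L primitiveL2).prod (meanL2.tildeL L2.continuous_avg)).codRestrict H1
    fun w => ⟨primitiveL2 w, isACRep_primitiveL2 w⟩
  deriv_antideriv _ := rfl
  avg_antideriv w := (avg_inclL2 _).trans (avg_primitiveL2 w)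
  rep_antideriv _ := inclL2_injective (H1rep_spec _).eq_inclL2.symm

end DerivativeOperators

end

theorem theorem1p2 (f : UnitAddCircle → ℝ → ℝ) (hf : IsSmoothNonlinearity f) (ht : IsTame f) :
    HasGlobalAdaptedCoordinates meanC1 meanC0 (operatorC f hf) ∧
    HasGlobalAdaptedCoordinates meanH1 meanL2 (operatorH f hf) :=
  ⟨derivativeOperatorC1.hasGlobalAdaptedCoordinates hf ht,
    derivativeOperatorH1.hasGlobalAdaptedCoordinates hf ht⟩
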